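/- Let $X$ be a real vector space, $\mathcal F$ a $\sigma$-algebra on $X$ stable under translations and under dilations of non-zero ratio. For a convex set $C\subset X$ put $M_C(x)=\inf\{t\ge 0 : x\in tC\}\in[0,+\infty]$; $C$ is called internal if $M_C$ is finite everywhere and $C=\{M_C<1\}$, and $\mathcal C_0(\mathcal F)$ denotes the set of internal convex sets belonging to $\mathcal F$. Let $(X,\mathcal C_0,\mathcal F,\tau)$ be a measurable locally convex space: $\mathcal C_0\subset\mathcal C_0(\mathcal F)$ is a non-empty family of symmetric sets, stable under finite intersections and under dilations of non-zero ratio, with $\bigcap_{C\in\mathcal C_0}C=\{0\}$; $\tau$ is the vector space topology on $X$ for which $\mathcal C_0$ is a fundamental system of neighbourhoods of $0$; and every element of the topological dual $X^*$ is $\mathcal F$-measurable. Let $d\ge 1$. A box is a translate $z+\Lambda(n)$ of some $\Lambda(n)=[0,n[^d\cap\mathbb Z^d$, $n\ge 1$, $z\in\mathbb Z^d$. For a box $\Lambda$ and $\sigma\in X^{\mathbb Z^d}$ let $\mathfrak m_\Lambda(\sigma)=|\Lambda|^{-1}\sum_{z\in\Lambda}\sigma(z)$, and for a finite $S\subset\mathbb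 Z^d$ let $\mathcal F_S$ be the $\sigma$-algebra on $X^{\mathbb Z^d}$ generated by the maps $\mathfrak m_\Lambda$, $\Lambda$ a box included in $S$. Let $(\mu_\Lambda)$ be a compatible system of translation invariant probabilities: for every box $\Lambda$, $\mu_\Lambda$ is a probability measure on $\mathcal F_\Lambda$; $\mu_{\Lambda_2}=\mu_{\Lambda_1}$ on $\mathcal F_{\Lambda_1}$ for all boxes $\Lambda_1\subset\Lambda_2$; and $\mu_{\Lambda+z}(A+z)=\mu_\Lambda(A)$ for every box $\Lambda$, every $A\in\mathcal F_\Lambda$ and every $z\in\mathbb Z^d$, where $A+z=\{\sigma(\cdot-z):\sigma\in A\}$. Write $\mathbb P(A)=\mu_\Lambda(A)$ for $A\in\mathcal F_\Lambda$, and similarly for conditional probabilities (inequalities between which hold almost surely). Let $D\subset X$ be convex, and assume that $(\mu_\Lambda)$ is - lower asymptotically decoupled: there are $g,c:\mathbb N^*\to[0,+\infty[$ with $g(m)/m\to0$ and $c(m)/|\Lambda(m)|\to0$ such that, for all $m\ge1$, all finite $S\subset\mathbb Z^d$, all $A\in\mathcal F_{\Lambda(m)}$ and $B\in\mathcal F_S$,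 if the $\ell^\infty$-distance between $S$ and $\Lambda(m)$ is $>g(m)$, then $\mathbb P(A\cap B)\ge e^{-c(m)}\,\mathbb P(A)\,\mathbb P(B)$; - locally controlled: there are $t,\alpha:\mathcal C_0(\mathcal F)\to{]0,+\infty[}$ such that $\mathbb P(\sigma(0)\in t(C)\cdot C\mid\mathcal F_{\Lambda\setminus\{0\}})\ge\alpha(C)$ for all $C\in\mathcal C_0(\mathcal F)$ and all boxes $\Lambda$; - carried by $D^{\mathbb Z^d}$: for every box $\Lambda$ and all $A,B\in\mathcal F_\Lambda$, $A\cap D^{\mathbb Z^d}=B\cap D^{\mathbb Z^d}$ implies $\mu_\Lambda(A)=\mu_\Lambda(B)$; - locally convex-tight on $D$: for every $\gamma>0$ there is $K(\gamma)\in\mathcal F$ such that $K(\gamma)\cap D$ is convex and relatively compact in $X$ and $\mathbb P(\sigma(0)\in K(\gamma)\mid\mathcal F_{\Lambda\setminus\{0\}})\ge1-\gamma$ for every box $\Lambda$ containing $0$. Let $\mu_n=\mu_{\Lambda(n)}\circ\mathfrak m_{\Lambda(n)}^{-1}$ for $n\ge1$, and define the entropy and the pressure, with values in $[-\infty,+\infty]$,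 by $$s(x)=\inf_{C\in\mathcal C_0}\ \liminf_{n\to\infty}\frac1{|\Lambda(n)|}\log\mu_n(x+C)\quad(x\in X),$$ $$p(\lambda)=\limsup_{n\to\infty}\frac1{|\Lambda(n)|}\log\int e^{|\Lambda(n)|\langle\lambda|y\rangle}\,d\mu_n(y)\quad(\lambda\in X^*).$$ Then the entropy is the negative of the Fenchel–Legendre transform of the pressure: $$\forall x\in X\qquad s(x)=\inf_{\lambda\in X^*}\big(p(\lambda)-\langle\lambda|x\rangle\big).$$ -/

import Mathlib

open MeasureTheory Filter Topology
open scoped Pointwise ENNReal NNReal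

section Gauge

variable {X : Type*} [AddCommGroup X] [Module ℝ X]

/-- The gauge `M_C(x) = inf {t ≥ 0 ; x ∈ t C}`, with values in `[0, +∞]`. -/
noncomputable def extGauge (C : Set X) (x : X) : ℝ≥0∞ :=
  ⨅ (t : ℝ≥0) (_ : x ∈ (t : ℝ) • C), (t : ℝ≥0∞)

/-- A convex set is internal if its gauge is finite everywhere and `C = {M_C < 1}`. -/
structure IsInternalConvex (C : Set X) : Prop where
  convex : Convex ℝ C
  gauge_lt_top : ∀ x, extGauge C x < ⊤
  eq_gauge_lt_one : C = {x | extGauge C x < 1}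

/-- `𝒞₀(𝓕)`: the measurable internal convex sets. -/
def measurableInternalConvexes (X : Type*) [AddCommGroup X] [Module ℝ X] [MeasurableSpace X] :
    Set (Set X) :=
  {C | IsInternalConvex C ∧ MeasurableSet C}

/-- `(X, C₀, 𝓕, τ)` is a measurable locally convex space, where `𝓕` and `τ` are the ambient
`MeasurableSpace` and `TopologicalSpace` (to be used with a vector space topology `τ`). -/
structure IsMeasurableLCS [MeasurableSpace X] [TopologicalSpace X] (C₀ : Set (Set X)) :
    Prop where
  measurableSet_vadd : ∀ (a : X) (A : Set X), MeasurableSet A → MeasurableSet (a +ᵥ A)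
  measurableSet_smul : ∀ (r : ℝ) (A : Set X), r ≠ 0 → MeasurableSet A → MeasurableSet (r • A)
  nonempty : C₀.Nonempty
  subset : C₀ ⊆ measurableInternalConvexes X
  symmetric : ∀ C ∈ C₀, -C = C
  inter_mem : ∀ C ∈ C₀, ∀ C' ∈ C₀, C ∩ C' ∈ C₀
  smul_mem : ∀ (r : ℝ), r ≠ 0 → ∀ C ∈ C₀, r • C ∈ C₀
  sInter_eq : ⋂₀ C₀ = {0}
  nhds_zero_basis : (𝓝 (0 : X)).HasBasis (fun C => C ∈ C₀) id
  measurable_dual : ∀ l : X →L[ℝ] ℝ, Measurable l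

end Gauge

/-- A box of `ℤ^d`, given by its lowest corner and its side length `n ≥ 1`. -/
structure LatticeBox (d : ℕ) where
  corner : Fin d → ℤ
  side : ℕ+

/-- The sites of the box: `corner + [0, side[^d`. -/
noncomputable def LatticeBox.sites {d : ℕ} (Λ : LatticeBox d) : Finset (Fin d → ℤ) :=
  Fintype.piFinset fun i => Finset.Ico (Λ.corner i) (Λ.corner i + (Λ.side : ℤ))

/-- `Λ + z`. -/
def LatticeBox.translate {d : ℕ} (Λ : LatticeBox d) (z : Fin d → ℤ) : LatticeBox d :=
  ⟨Λ.corner + z, Λ.side⟩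

/-- `Λ(n) = [0, n[^d`. -/
def LatticeBox.cube (d : ℕ) (n : ℕ+) : LatticeBox d := ⟨0, n⟩

/-- Configurations. They are never used with the product σ-algebra, only with `fieldSigma S`. -/
abbrev Config (d : ℕ) (X : Type*) := (Fin d → ℤ) → X

section Fields

variable {X : Type*} [AddCommGroup X] [Module ℝ X] {d : ℕ}

/-- The empirical mean `𝔪_Λ(σ) = |Λ|⁻¹ ∑_{z ∈ Λ} σ(z)`. -/
noncomputable def empMean (Λ : LatticeBox d) (σ : Config d X) : X :=
  ((Λ.sites.card : ℝ)⁻¹) • ∑ z ∈ Λ.sites, σ z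

/-- `A + z = {σ(· - z) ; σ ∈ A}`. -/
def shiftSet (z : Fin d → ℤ) (A : Set (Config d X)) : Set (Config d X) :=
  (fun (σ : Config d X) (w : Fin d → ℤ) => σ (w - z)) '' A

/-- `D^{ℤ^d}`. -/
def fieldsIn (d : ℕ) (D : Set X) : Set (Config d X) := {σ | ∀ z, σ z ∈ D}

variable [MeasurableSpace X]

/-- `𝓕_S`: the σ-algebra generated by the means `𝔪_Λ` over the boxes `Λ ⊆ S`. -/
@[reducible] noncomputable def fieldSigma (X : Type*) [AddCommGroup X] [Module ℝ X] [MeasurableSpace X] {d : ℕ}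
    (S : Finset (Fin d → ℤ)) : MeasurableSpace (Config d X) :=
  ⨆ (Λ : LatticeBox d) (_ : Λ.sites ⊆ S),
    MeasurableSpace.comap (empMean Λ) (inferInstance : MeasurableSpace X)

/-- A compatible system of translation invariant probabilities `(μ_Λ)` on `X^{ℤ^d}`. -/
structure InvariantSystem (d : ℕ) (X : Type*) [AddCommGroup X] [Module ℝ X]
    [MeasurableSpace X] where
  law : (Λ : LatticeBox d) → @Measure (Config d X) (fieldSigma X Λ.sites)
  law_univ : ∀ Λ, law Λ Set.univ = 1
  compatible : ∀ Λ₁ Λ₂ : LatticeBox d, Λ₁.sites ⊆ Λ₂.sites →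
    ∀ A, MeasurableSet[fieldSigma X Λ₁.sites] A → law Λ₂ A = law Λ₁ A
  invariant : ∀ (Λ : LatticeBox d) (z : Fin d → ℤ),
    ∀ A, MeasurableSet[fieldSigma X Λ.sites] A → law (Λ.translate z) (shiftSet z A) = law Λ A

namespace InvariantSystem

variable (μ : InvariantSystem d X)

/-- The conditional probability `μ_Λ(A | 𝓖)`. -/
noncomputable def condProb (Λ : LatticeBox d) (𝓖 : MeasurableSpace (Config d X))
    (A : Set (Config d X)) : Config d X → ℝ :=
  condExp 𝓖 (μ.law Λ) (A.indicator fun _ => (1 : ℝ))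

/-- The system is carried by a set `E` of configurations. -/
def CarriedBy (E : Set (Config d X)) : Prop :=
  ∀ (Λ : LatticeBox d) (A B : Set (Config d X)),
    MeasurableSet[fieldSigma X Λ.sites] A → MeasurableSet[fieldSigma X Λ.sites] B →
    A ∩ E = B ∩ E → μ.law Λ A = μ.law Λ B

/-- Lower asymptotic decoupling. The probabilities of `A`, `B` and `A ∩ B` are read off in any
box containing all the sites involved. The distance on `Fin d → ℤ` is the sup-norm distance. -/
def LowerAsymptoticallyDecoupled : Prop :=
  ∃ g c : ℕ+ → ℝ, (∀ m, 0 ≤ g m) ∧ (∀ m, 0 ≤ c m) ∧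
    Tendsto (fun m : ℕ+ => g m / (m : ℝ)) atTop (𝓝 0) ∧
    Tendsto (fun m : ℕ+ => c m / ((LatticeBox.cube d m).sites.card : ℝ)) atTop (𝓝 0) ∧
    ∀ (m : ℕ+) (S : Finset (Fin d → ℤ)) (A B : Set (Config d X)),
      MeasurableSet[fieldSigma X (LatticeBox.cube d m).sites] A →
      MeasurableSet[fieldSigma X S] B →
      (∀ s ∈ S, ∀ z ∈ (LatticeBox.cube d m).sites, g m < dist s z) →
      ∀ Λ : LatticeBox d, (LatticeBox.cube d m).sites ⊆ Λ.sites → S ⊆ Λ.sites →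
        ENNReal.ofReal (Real.exp (-c m)) * μ.law Λ A * μ.law Λ B ≤ μ.law Λ (A ∩ B)

/-- Local control: `ℙ(σ(0) ∈ t(C)·C | 𝓕_{Λ ∖ {0}}) ≥ α(C)`, the conditional probability being
computed in any box `Λ'` containing `Λ ∪ {0}`. -/
def LocallyControlled : Prop :=
  ∃ t α : Set X → ℝ, ∀ C ∈ measurableInternalConvexes X, 0 < t C ∧ 0 < α C ∧
    ∀ Λ Λ' : LatticeBox d, Λ.sites ⊆ Λ'.sites → (0 : Fin d → ℤ) ∈ Λ'.sites →
      ∀ᵐ σ ∂(μ.law Λ'),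
        α C ≤ μ.condProb Λ' (fieldSigma X (Λ.sites.erase 0)) {η | η 0 ∈ t C • C} σ

/-- Local convex-tightness on `D`. -/
def LocallyConvexTight [TopologicalSpace X] (D : Set X) : Prop :=
  ∀ γ : ℝ, 0 < γ → ∃ K : Set X, MeasurableSet K ∧ Convex ℝ (K ∩ D) ∧
    IsCompact (closure (K ∩ D)) ∧
    ∀ Λ : LatticeBox d, (0 : Fin d → ℤ) ∈ Λ.sites →
      ∀ᵐ σ ∂(μ.law Λ),
        1 - γ ≤ μ.condProb Λ (fieldSigma X (Λ.sites.erase 0)) {η | η 0 ∈ K} σ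

/-- The Cramér sequence: `μ_n` is the law of `𝔪_{Λ(n)}` under `μ_{Λ(n)}`. -/
noncomputable def cramer (n : ℕ+) : Measure X :=
  @Measure.map (Config d X) X (fieldSigma X (LatticeBox.cube d n).sites) _
    (empMean (LatticeBox.cube d n)) (μ.law (LatticeBox.cube d n))

/-- `s(x) = inf_{C ∈ C₀} liminf_n |Λ(n)|⁻¹ log μ_n(x + C)`. -/
noncomputable def entropy (C₀ : Set (Set X)) (x : X) : EReal :=
  ⨅ C ∈ C₀, liminf (fun n : ℕ+ =>
    ENNReal.log (μ.cramer n (x +ᵥ C)) / ((LatticeBox.cube d n).sites.card : EReal)) atTop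

/-- `p(l) = limsup_n |Λ(n)|⁻¹ log ∫ exp(|Λ(n)| ⟨l|x⟩) dμ_n(x)`. -/
noncomputable def pressure [TopologicalSpace X] (l : X →L[ℝ] ℝ) : EReal :=
  limsup (fun n : ℕ+ =>
    ENNReal.log (∫⁻ x, ENNReal.ofReal
      (Real.exp (((LatticeBox.cube d n).sites.card : ℝ) * l x)) ∂(μ.cramer n))
      / ((LatticeBox.cube d n).sites.card : EReal)) atTop

end InvariantSystem

end Fields

/-! ### Internal convex sets as balls of continuous seminorms -/

section Gauge

variable {X : Type*} [AddCommGroup X] [Module ℝ X]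

/-! The inequality `s(x) ≤ p(l) - l(x)` is the exponential Chebyshev bound on a neighbourhood `x +
C` where `l` varies little (`entropy_le_pressure_sub`).

For the converse, fix `C` in `C₀`, the unit ball of a seminorm `p`, and consider the pairs `(y, r)`
for which the ball of centre `y` has exponential rate above `r`, with some room in radius and level
(`rateSet`). This room makes the set open, and decoupling makes it convex (`convex_rateSet`). If
`s(x) < a < inf (p(l) - l(x))`, a suitable `C` leaves `(x, a)` outside this set, and Hahn-Banach in
`X × ℝ` gives a separating functional. It is contradicted by `exists_mem_rateSet_of_lt_pressure`:
for each `l`, every level below `p(l)` is exceeded by `l(y) + r` at some point `(y, r)` of the set.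

Both uses of decoupling rest on one construction: a large cube is tiled by cubes of side `m`
separated by corridors, the tile means are prescribed at the cost of decoupling, and the corridor
spins are kept bounded by local control (`eventually_le_cramer_ball`). The corridors have vanishing
density as `m` grows. Convexity comes from prescribing two values in the right proportions. The
bound by the pressure comes from Cramér's lower bound, by tilting, for independent copies of a
discretised `μ_m`.

Tightness is used only at a fixed scale `m`, to replace `μ_m` by finitely many atoms. No compactness
at exponential scale is needed, since only open convex sets are separated. -/

theorem IsInternalConvex.exists_nnreal_lt_one {C : Set X} (hC : IsInternalConvex C) {x : X}
    (hx : x ∈ C) : ∃ t : ℝ≥0, t < 1 ∧ x ∈ (t : ℝ) • C := by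
  rw [hC.eq_gauge_lt_one] at hx
  simp only [Set.mem_ofPred_eq, extGauge, iInf_lt_iff] at hx
  obtain ⟨t, ht, h⟩ := hx
  exact ⟨t, by exact_mod_cast h, ht⟩

/-- A symmetric internal convex neighbourhood of the origin is the open unit ball of a continuous
seminorm. -/
theorem IsMeasurableLCS.exists_seminorm [TopologicalSpace X] [IsTopologicalAddGroup X]
    [ContinuousSMul ℝ X] [MeasurableSpace X] {C₀ : Set (Set X)} (hX : IsMeasurableLCS C₀)
    {C : Set X} (hC : C ∈ C₀) : ∃ p : Seminorm ℝ X, Continuous p ∧ p.ball 0 1 = C := by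
  have hint := (hX.subset hC).1
  have hnhds : C ∈ 𝓝 (0 : X) := hX.nhds_zero_basis.mem_of_mem hC
  have hcv : Convex ℝ C := hint.convex
  have h0 : (0 : X) ∈ C := mem_of_mem_nhds hnhds
  have habs : Absorbent ℝ C := absorbent_nhds_zero hnhds
  have hbal : Balanced ℝ C := by
    intro a ha
    rintro _ ⟨x, hx, rfl⟩
    have hneg : ∀ y ∈ C, -y ∈ C := fun y hy => by
      rw [← hX.symmetric C hC]; simpa using hy
    rw [Real.norm_eq_abs, abs_le] at ha
    -- For `|a| ≤ 1`, the point `a • x` lies on the segment from `-x` to `x`.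
    have := hcv (hneg x hx) hx (a := (1 - a) / 2) (b := (1 + a) / 2) (by linarith) (by linarith)
      (by ring)
    convert this using 1
    module
  have hlt : ∀ x, gauge C x < 1 ↔ x ∈ C := by
    intro x
    constructor
    · intro h
      exact setOfPred_gauge_lt_one_subset_self hcv h0 habs h
    · intro h
      -- Internality excludes boundary points of gauge exactly one.
      obtain ⟨t, ht, hx⟩ := hint.exists_nnreal_lt_one h
      exact (gauge_le_of_mem t.2 hx).trans_lt (by exact_mod_cast ht)
  refine ⟨gaugeSeminorm hbal hcv habs, ?_, ?_⟩
  · exact continuous_gauge hcv hnhds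
  · ext x
    rw [Seminorm.mem_ball_zero]
    exact hlt x

theorem Seminorm.ball_eq_vadd_smul (p : Seminorm ℝ X) (y : X) {r : ℝ} (hr : 0 < r) :
    p.ball y r = y +ᵥ (r • p.ball 0 1) := by
  rw [Seminorm.smul_ball_zero hr.ne', Real.norm_eq_abs, abs_of_pos hr, mul_one,
    Seminorm.vadd_ball]
  simp

namespace IsMeasurableLCS

variable [TopologicalSpace X] [MeasurableSpace X] {C₀ : Set (Set X)}

theorem measurableSet_ball (hX : IsMeasurableLCS C₀) {p : Seminorm ℝ X} (hp : p.ball 0 1 ∈ C₀)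
    (y : X) {r : ℝ} (hr : 0 < r) : MeasurableSet (p.ball y r) := by
  rw [p.ball_eq_vadd_smul y hr]
  exact hX.measurableSet_vadd _ _ (hX.measurableSet_smul _ _ hr.ne' (hX.subset hp).2)

end IsMeasurableLCS

end Gauge

/-! ### Integrated form of conditional bounds -/

section CondProb

/-- A lower bound on a conditional probability gives a lower bound on intersections. -/
theorem ofReal_mul_measure_le_of_le_condExp {Ω : Type*} {m m₀ : MeasurableSpace Ω} (hm : m ≤ m₀)
    (P : Measure Ω) [IsProbabilityMeasure P] {E B : Set Ω} (hE : MeasurableSet E)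
    (hB : MeasurableSet[m] B) {a : ℝ}
    (h : ∀ᵐ ω ∂P, a ≤ condExp m P (E.indicator fun _ => (1 : ℝ)) ω) :
    ENNReal.ofReal a * P B ≤ P (E ∩ B) := by
  have hint : Integrable (E.indicator fun _ => (1 : ℝ)) P :=
    (integrable_const (1 : ℝ)).indicator hE
  have h1 := setIntegral_condExp hm hint hB
  have h2 : ∫ x in B, E.indicator (fun _ => (1 : ℝ)) x ∂P = P.real (E ∩ B) := by
    rw [integral_indicator hE, setIntegral_const, smul_eq_mul, mul_one, measureReal_restrict_apply hE]
  have h3 : ∫ x in B, a ∂P ≤ ∫ x in B, (condExp m P (E.indicator fun _ => (1 : ℝ))) x ∂P :=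
    integral_mono_ae (integrable_const _) integrable_condExp.integrableOn
      (ae_restrict_of_ae h)
  rw [h1, h2, setIntegral_const, smul_eq_mul] at h3
  rw [← ENNReal.ofReal_toReal (measure_ne_top P B), ← ENNReal.ofReal_toReal (measure_ne_top P (E ∩ B)),
    ← ENNReal.ofReal_mul' ENNReal.toReal_nonneg]
  apply ENNReal.ofReal_le_ofReal
  rw [mul_comm]
  exact h3

end CondProb

/-! ### Boxes and their translates -/

namespace LatticeBox

variable {d : ℕ}

theorem mem_sites {Λ : LatticeBox d} {w : Fin d → ℤ} :
    w ∈ Λ.sites ↔ ∀ i, Λ.corner i ≤ w i ∧ w i < Λ.corner i + Λ.side := by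
  simp [sites]

theorem mem_sites_translate {Λ : LatticeBox d} {z w : Fin d → ℤ} :
    w ∈ (Λ.translate z).sites ↔ w - z ∈ Λ.sites := by
  simp only [mem_sites, translate, Pi.add_apply, Pi.sub_apply]
  refine forall_congr' fun i => ?_
  constructor <;> rintro ⟨h1, h2⟩ <;> constructor <;> linarith

theorem card_sites (Λ : LatticeBox d) : Λ.sites.card = (Λ.side : ℕ) ^ d := by
  simp [sites]

theorem card_sites_pos (Λ : LatticeBox d) : 0 < Λ.sites.card := by
  rw [card_sites]; positivity

theorem sites_translate_eq_map (Λ : LatticeBox d) (z : Fin d → ℤ) :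
    (Λ.translate z).sites = Λ.sites.map (addRightEmbedding z) := by
  ext w
  simp only [mem_sites_translate, Finset.mem_map, addRightEmbedding_apply]
  constructor
  · intro h; exact ⟨w - z, h, by simp⟩
  · rintro ⟨v, h, rfl⟩; simpa using h

end LatticeBox

theorem shiftSet_eq_preimage {X : Type*} {d : ℕ} (z : Fin d → ℤ) (A : Set (Config d X)) :
    shiftSet z A = (fun (σ : Config d X) (w : Fin d → ℤ) => σ (w + z)) ⁻¹' A := by
  ext σ
  constructor
  · rintro ⟨τ, hτ, rfl⟩
    simpa using hτ
  · intro h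
    exact ⟨_, h, by simp⟩

/-! ### Box means, their σ-algebras and translation invariance -/

section Fields

variable {X : Type*} [AddCommGroup X] [Module ℝ X] {d : ℕ}

theorem empMean_translate (Λ : LatticeBox d) (z : Fin d → ℤ) (σ : Config d X) :
    empMean (Λ.translate z) σ = empMean Λ (fun w => σ (w + z)) := by
  simp only [empMean, LatticeBox.card_sites]
  rw [LatticeBox.sites_translate_eq_map, Finset.sum_map]
  simp [LatticeBox.translate]

theorem empMean_singleton (z : Fin d → ℤ) (σ : Config d X) :
    empMean (⟨z, 1⟩ : LatticeBox d) σ = σ z := by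
  have : (⟨z, 1⟩ : LatticeBox d).sites = {z} := by
    ext w
    simp only [LatticeBox.mem_sites, Finset.mem_singleton, funext_iff]
    refine forall_congr' fun i => ?_
    simp only [PNat.one_coe, Nat.cast_one]
    omega
  simp [empMean, this]

variable [MeasurableSpace X]

theorem measurable_empMean {Λ : LatticeBox d} {S : Finset (Fin d → ℤ)} (h : Λ.sites ⊆ S) :
    @Measurable _ _ (fieldSigma X S) _ (empMean Λ : Config d X → X) := by
  rw [measurable_iff_comap_le]
  exact le_iSup₂_of_le Λ h le_rfl

theorem measurableSet_empMean_preimage {Λ : LatticeBox d} {S : Finset (Fin d → ℤ)}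
    (h : Λ.sites ⊆ S) {A : Set X} (hA : MeasurableSet A) :
    MeasurableSet[fieldSigma X S] ((empMean Λ : Config d X → X) ⁻¹' A) :=
  measurable_empMean h hA

/-- A single site is a box of side one, so its spin is itself one of the generating means. -/
theorem measurableSet_eval_preimage {z : Fin d → ℤ} {S : Finset (Fin d → ℤ)} (h : z ∈ S)
    {A : Set X} (hA : MeasurableSet A) :
    MeasurableSet[fieldSigma X S] {σ : Config d X | σ z ∈ A} := by
  have := measurableSet_empMean_preimage (Λ := ⟨z, 1⟩) (S := S) ?_ hA
  · convert this using 1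
    ext σ
    simp [empMean_singleton]
  · intro w hw
    have : w = z := by
      ext i
      have := LatticeBox.mem_sites.1 hw i
      simp only [PNat.one_coe, Nat.cast_one] at this
      omega
    rwa [this]

theorem fieldSigma_mono {S T : Finset (Fin d → ℤ)} (h : S ⊆ T) :
    fieldSigma X S ≤ fieldSigma X T :=
  iSup₂_le fun Λ hΛ => le_iSup₂_of_le Λ (hΛ.trans h) le_rfl

theorem measurableSet_shiftSet {S T : Finset (Fin d → ℤ)} {z : Fin d → ℤ}
    (h : ∀ s ∈ S, s + z ∈ T) {A : Set (Config d X)} (hA : MeasurableSet[fieldSigma X S] A) :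
    MeasurableSet[fieldSigma X T] (shiftSet z A) := by
  rw [shiftSet_eq_preimage]
  have : @Measurable _ _ (fieldSigma X T) (fieldSigma X S)
      (fun (σ : Config d X) (w : Fin d → ℤ) => σ (w + z)) := by
    rw [measurable_iff_comap_le]
    simp only [MeasurableSpace.comap_iSup, MeasurableSpace.comap_comp]
    refine iSup₂_le fun Λ hΛ => ?_
    refine le_iSup₂_of_le (Λ.translate z) ?_ ?_
    · intro w hw
      have := h _ (hΛ (LatticeBox.mem_sites_translate.1 hw))
      simpa using this
    · apply le_of_eq
      congr 1
      ext σ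
      simp [empMean_translate]
  exact this hA

namespace InvariantSystem

variable (μ : InvariantSystem d X)

theorem isProbabilityMeasure_law (Λ : LatticeBox d) :
    @IsProbabilityMeasure _ (fieldSigma X Λ.sites) (μ.law Λ) :=
  @IsProbabilityMeasure.mk _ (fieldSigma X Λ.sites) (μ.law Λ) (μ.law_univ Λ)

theorem cramer_apply (n : ℕ+) {A : Set X} (hA : MeasurableSet A) :
    μ.cramer n A = μ.law (LatticeBox.cube d n) (empMean (LatticeBox.cube d n) ⁻¹' A) :=
  @Measure.map_apply _ _ (fieldSigma X _) _ _ _ (measurable_empMean subset_rfl) _ hA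

instance isProbabilityMeasure_cramer (n : ℕ+) : IsProbabilityMeasure (μ.cramer n) :=
  ⟨by rw [μ.cramer_apply n MeasurableSet.univ]; exact μ.law_univ _⟩

/-- Decoupling of the mean over a translated cube from a far event. -/
theorem decoupled_translate {gm cm : ℝ} {m : ℕ+}
    (hdec : ∀ (S : Finset (Fin d → ℤ)) (A B : Set (Config d X)),
      MeasurableSet[fieldSigma X (LatticeBox.cube d m).sites] A →
      MeasurableSet[fieldSigma X S] B →
      (∀ s ∈ S, ∀ z ∈ (LatticeBox.cube d m).sites, gm < dist s z) →
      ∀ Λ : LatticeBox d, (LatticeBox.cube d m).sites ⊆ Λ.sites → S ⊆ Λ.sites →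
        ENNReal.ofReal (Real.exp (-cm)) * μ.law Λ A * μ.law Λ B ≤ μ.law Λ (A ∩ B))
    {Λ : LatticeBox d} {z : Fin d → ℤ} {S : Finset (Fin d → ℤ)}
    (hz : ((LatticeBox.cube d m).translate z).sites ⊆ Λ.sites) (hS : S ⊆ Λ.sites)
    (hd : ∀ s ∈ S, ∀ w ∈ ((LatticeBox.cube d m).translate z).sites, gm < dist s w)
    {A : Set X} (hA : MeasurableSet A) {B : Set (Config d X)}
    (hB : MeasurableSet[fieldSigma X S] B) :
    ENNReal.ofReal (Real.exp (-cm)) * μ.cramer m A * μ.law Λ B ≤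
      μ.law Λ (empMean ((LatticeBox.cube d m).translate z) ⁻¹' A ∩ B) := by
  have hB' := fieldSigma_mono (X := X) hS _ hB
  have hA' := measurableSet_empMean_preimage (X := X) hz hA
  have hS' : ∀ s ∈ S, s + -z ∈ S.image (· + -z) := fun s hs => Finset.mem_image_of_mem _ hs
  -- Decoupling is assumed only for the cube at the origin, so the whole picture is translated by
  -- `-z`.
  rw [← μ.invariant Λ (-z) _ hB', ← μ.invariant Λ (-z) _ (@MeasurableSet.inter _ (fieldSigma X _) _ _ hA' hB')]
  have e : shiftSet (-z) (empMean ((LatticeBox.cube d m).translate z) ⁻¹' A ∩ B) =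
      empMean (LatticeBox.cube d m) ⁻¹' A ∩ shiftSet (-z) B := by
    simp only [shiftSet_eq_preimage, Set.preimage_inter]
    congr 1
    ext σ
    simp [empMean_translate]
  have hsub : (LatticeBox.cube d m).sites ⊆ (Λ.translate (-z)).sites := by
    intro w hw
    rw [LatticeBox.mem_sites_translate]
    apply hz
    rw [LatticeBox.mem_sites_translate]
    simpa using hw
  have hcr : μ.cramer m A = μ.law (Λ.translate (-z)) (empMean (LatticeBox.cube d m) ⁻¹' A) := by
    rw [μ.cramer_apply m hA]
    exact (μ.compatible _ _ hsub _ (measurableSet_empMean_preimage subset_rfl hA)).symm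
  rw [e, hcr]
  refine hdec (S.image (· + -z)) _ _ (measurableSet_empMean_preimage subset_rfl hA)
    (measurableSet_shiftSet hS' hB) ?_ _ hsub ?_
  · intro s hs w hw
    obtain ⟨s, hs₁, rfl⟩ := Finset.mem_image.1 hs
    have := hd s hs₁ (w + z) (by rw [LatticeBox.mem_sites_translate]; simpa using hw)
    convert this using 1
    rw [dist_eq_norm, dist_eq_norm]
    congr 1
    abel
  · intro s hs
    obtain ⟨s, hs₁, rfl⟩ := Finset.mem_image.1 hs
    rw [LatticeBox.mem_sites_translate]
    simpa using hS hs₁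

/-- A conditional lower bound at the origin, transported to an arbitrary site. -/
theorem ofReal_mul_law_le_eval {a : ℝ} {E : Set X} (hE : MeasurableSet E)
    (h : ∀ Λ : LatticeBox d, (0 : Fin d → ℤ) ∈ Λ.sites → ∀ᵐ σ ∂(μ.law Λ),
      a ≤ μ.condProb Λ (fieldSigma X (Λ.sites.erase 0)) {η | η 0 ∈ E} σ)
    {Λ : LatticeBox d} {z : Fin d → ℤ} (hz : z ∈ Λ.sites) {S : Finset (Fin d → ℤ)}
    (hS : S ⊆ Λ.sites) (hzS : z ∉ S) {B : Set (Config d X)}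
    (hB : MeasurableSet[fieldSigma X S] B) :
    ENNReal.ofReal a * μ.law Λ B ≤ μ.law Λ ({σ | σ z ∈ E} ∩ B) := by
  have hB' := fieldSigma_mono (X := X) hS _ hB
  have hE' := measurableSet_eval_preimage (X := X) hz hE
  rw [← μ.invariant Λ (-z) _ hB', ← μ.invariant Λ (-z) _ (@MeasurableSet.inter _ (fieldSigma X _) _ _ hE' hB')]
  have e : shiftSet (-z) ({σ : Config d X | σ z ∈ E} ∩ B) =
      {σ | σ 0 ∈ E} ∩ shiftSet (-z) B := by
    simp only [shiftSet_eq_preimage, Set.preimage_inter]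
    congr 1
    ext σ
    simp
  have h0 : (0 : Fin d → ℤ) ∈ (Λ.translate (-z)).sites := by
    rw [LatticeBox.mem_sites_translate]; simpa using hz
  rw [e]
  refine @ofReal_mul_measure_le_of_le_condExp _ _ (fieldSigma X _)
    (fieldSigma_mono (Finset.erase_subset _ _)) _ (μ.isProbabilityMeasure_law _) _ _
    (measurableSet_eval_preimage h0 hE) ?_ _ (h _ h0)
  -- Since `z ∉ S`, the shifted `S` avoids the origin, and the shifted event belongs to the
  -- conditioning σ-algebra.
  refine measurableSet_shiftSet ?_ hB
  intro s hs
  rw [Finset.mem_erase]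
  constructor
  · intro h
    rw [add_neg_eq_zero] at h
    exact hzS (h ▸ hs)
  · rw [LatticeBox.mem_sites_translate]; simpa using hS hs

end InvariantSystem

end Fields

/-! ### Periodic tilings and finite-volume lower bounds -/

section Tilings

namespace LatticeBox

variable {d : ℕ}

/-- The number of cubes of side `m` placed periodically, with period `m + s`, in the cube of side
`n`. -/
abbrev tileCount (d : ℕ) (m : ℕ+) (s n : ℕ) : ℕ := (n / (m + s)) ^ d

/-- The cubes of side `m` placed periodically, with period `m + s`, in the cube of side `n`. -/
def tile (d : ℕ) (m : ℕ+) (s n : ℕ) (j : Fin (tileCount d m s n)) : LatticeBox d :=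
  (cube d m).translate fun i => ((m + s : ℕ) : ℤ) * ((finFunctionFinEquiv.symm j i : ℕ) : ℤ)

theorem mem_sites_tile {m : ℕ+} {s n : ℕ} {j : Fin (tileCount d m s n)} {w : Fin d → ℤ} :
    w ∈ (tile d m s n j).sites ↔ ∀ i,
      ((m + s : ℕ) : ℤ) * ((finFunctionFinEquiv.symm j i : ℕ) : ℤ) ≤ w i ∧
        w i < ((m + s : ℕ) : ℤ) * ((finFunctionFinEquiv.symm j i : ℕ) : ℤ) + (m : ℕ) := by
  simp [tile, mem_sites, translate, cube]

theorem sites_tile_subset {m : ℕ+} {s : ℕ} {n : ℕ+} (j : Fin (tileCount d m s n)) :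
    (tile d m s n j).sites ⊆ (cube d n).sites := by
  intro w hw
  rw [mem_sites_tile] at hw
  rw [mem_sites]
  intro i
  obtain ⟨h1, h2⟩ := hw i
  have h3 : (finFunctionFinEquiv.symm j i : ℕ) + 1 ≤ (n : ℕ) / (m + s) :=
    (finFunctionFinEquiv.symm j i).2
  have h4 : (m + s) * ((finFunctionFinEquiv.symm j i : ℕ) + 1) ≤ (n : ℕ) :=
    (Nat.mul_le_mul_left _ h3).trans (Nat.mul_div_le _ _)
  have h5 : ((m + s : ℕ) : ℤ) * ((finFunctionFinEquiv.symm j i : ℕ) + 1) ≤ ((n : ℕ) : ℤ) := by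
    exact_mod_cast h4
  have h6 : (0 : ℤ) ≤ ((m + s : ℕ) : ℤ) * ((finFunctionFinEquiv.symm j i : ℕ) : ℤ) := by
    positivity
  have h7 : ((m + s : ℕ) : ℤ) = (m : ℕ) + (s : ℤ) := by push_cast; rfl
  simp only [cube, Pi.zero_apply]
  constructor
  · linarith
  · have : (0 : ℤ) ≤ s := by positivity
    rw [mul_add, mul_one] at h5
    linarith

/-- Along a coordinate where the indices differ, `s` integers lie between the half-open tiles,
whence a gap `s + 1`. With `s = ⌊g m⌋₊` it strictly exceeds `g m`. -/
theorem lt_dist_of_mem_tile {m : ℕ+} {s n : ℕ} {j j' : Fin (tileCount d m s n)} (hj : j ≠ j')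
    {v w : Fin d → ℤ} (hv : v ∈ (tile d m s n j).sites) (hw : w ∈ (tile d m s n j').sites) :
    (s : ℝ) + 1 ≤ dist v w := by
  have : finFunctionFinEquiv.symm j ≠ finFunctionFinEquiv.symm j' :=
    fun h => hj (finFunctionFinEquiv.symm.injective h)
  obtain ⟨i, hi⟩ := Function.ne_iff.1 this
  refine le_trans ?_ (dist_le_pi_dist v w i)
  rw [mem_sites_tile] at hv hw
  obtain ⟨h1, h2⟩ := hv i
  obtain ⟨h3, h4⟩ := hw i
  set a : ℕ := (finFunctionFinEquiv.symm j i : ℕ)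
  set b : ℕ := (finFunctionFinEquiv.symm j' i : ℕ)
  have hab : a ≠ b := fun h => hi (Fin.ext h)
  have key : (s : ℤ) + 1 ≤ |v i - w i| := by
    rw [le_abs]
    push_cast at h1 h2 h3 h4
    rcases lt_or_gt_of_ne hab with h | h
    · right
      have : ((m : ℕ) + (s : ℤ)) * ((a : ℤ) + 1) ≤ ((m : ℕ) + (s : ℤ)) * b := by
        gcongr; exact_mod_cast h
      linarith
    · left
      have : ((m : ℕ) + (s : ℤ)) * ((b : ℤ) + 1) ≤ ((m : ℕ) + (s : ℤ)) * a := by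
        gcongr; exact_mod_cast h
      linarith
  rw [Int.dist_eq]
  exact_mod_cast key

theorem pairwiseDisjoint_tile (m : ℕ+) (s n : ℕ) :
    Pairwise fun j j' : Fin (tileCount d m s n) =>
      Disjoint (tile d m s n j).sites (tile d m s n j').sites := by
  intro j j' hj
  rw [Finset.disjoint_left]
  intro v hv hw
  have := lt_dist_of_mem_tile hj hv hw
  rw [dist_self] at this
  have : (0 : ℝ) ≤ s := by positivity
  linarith

/-- The sites of the cube of side `n` which lie in no tile. -/
noncomputable def gaps (d : ℕ) (m : ℕ+) (s : ℕ) (n : ℕ+) : Finset (Fin d → ℤ) :=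
  (cube d n).sites \ Finset.univ.biUnion fun j => (tile d m s n j).sites

theorem biUnion_tile_subset (m : ℕ+) (s : ℕ) (n : ℕ+) :
    (Finset.univ.biUnion fun j => (tile d m s n j).sites) ⊆ (cube d n).sites :=
  Finset.biUnion_subset.2 fun j _ => sites_tile_subset j

theorem card_sites_tile {m : ℕ+} {s n : ℕ} (j : Fin (tileCount d m s n)) :
    (tile d m s n j).sites.card = (m : ℕ) ^ d := by
  rw [card_sites]; rfl

theorem card_biUnion_tile (m : ℕ+) (s n : ℕ) :
    (Finset.univ.biUnion fun j => (tile d m s n j).sites).card =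
      tileCount d m s n * (m : ℕ) ^ d := by
  rw [Finset.card_biUnion fun j _ j' _ h => pairwiseDisjoint_tile m s n h]
  simp [card_sites_tile]

theorem card_gaps_add (m : ℕ+) (s : ℕ) (n : ℕ+) :
    (gaps d m s n).card + tileCount d m s n * (m : ℕ) ^ d = (n : ℕ) ^ d := by
  have := Finset.card_sdiff_add_card_eq_card (biUnion_tile_subset (d := d) m s n)
  rw [card_biUnion_tile, card_sites] at this
  exact this

end LatticeBox

open LatticeBox

variable {X : Type*} [AddCommGroup X] [Module ℝ X] {d : ℕ}

theorem sum_sites_eq_smul_empMean (Λ : LatticeBox d) (σ : Config d X) :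
    ∑ z ∈ Λ.sites, σ z = (Λ.sites.card : ℝ) • empMean Λ σ := by
  rw [empMean, smul_smul, mul_inv_cancel₀, one_smul]
  exact_mod_cast Λ.card_sites_pos.ne'

theorem smul_empMean_cube_eq (m : ℕ+) (s : ℕ) (n : ℕ+) (σ : Config d X) :
    (((n : ℕ) ^ d : ℕ) : ℝ) • empMean (cube d n) σ =
      (((m : ℕ) ^ d : ℕ) : ℝ) • ∑ j, empMean (tile d m s n j) σ + ∑ z ∈ gaps d m s n, σ z := by
  have h1 : (((n : ℕ) ^ d : ℕ) : ℝ) = ((cube d n).sites.card : ℝ) := by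
    rw [card_sites]; rfl
  rw [h1, ← sum_sites_eq_smul_empMean, ← Finset.sum_sdiff (biUnion_tile_subset m s n), add_comm,
    Finset.sum_biUnion fun j _ j' _ h => pairwiseDisjoint_tile m s n h, Finset.smul_sum]
  congr 1
  refine Finset.sum_congr rfl fun j _ => ?_
  rw [sum_sites_eq_smul_empMean, card_sites_tile]

/-- If the tile means are close to given values and the remaining spins are bounded, then the
global mean is close to the mean of the given values. -/
theorem seminorm_empMean_cube_sub_lt (p : Seminorm ℝ X) {m : ℕ+} {s : ℕ} {n : ℕ+}
    {σ : Config d X} {v : Fin (tileCount d m s n) → X} {ybar : X} {η δ t r : ℝ} (hη : 0 ≤ η)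
    (hδ : 0 ≤ δ)
    (h₁ : ∀ j, empMean (tile d m s n j) σ ∈ p.ball (v j) η)
    (h₂ : ∀ z ∈ gaps d m s n, σ z ∈ p.ball 0 t)
    (h₃ : p (∑ j, v j - (tileCount d m s n : ℕ) • ybar) ≤
      (tileCount d m s n : ℕ) * δ)
    (hr : η + δ + (1 - (((m : ℕ) ^ d * tileCount d m s n : ℕ) : ℝ) / ((n : ℕ) ^ d : ℕ)) * t
      < r) :
    empMean (cube d n) σ ∈
      p.ball (((((m : ℕ) ^ d * tileCount d m s n : ℕ) : ℝ) / ((n : ℕ) ^ d : ℕ)) • ybar) r := by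
  set M : ℕ := (m : ℕ) ^ d
  set N : ℕ := (n : ℕ) ^ d
  have hN : (0 : ℝ) < N := by
    have : 0 < N := by positivity
    exact_mod_cast this
  have hM : (0 : ℝ) ≤ M := by positivity
  have hcard : ((gaps d m s n).card : ℝ) + tileCount d m s n * M = N := by
    exact_mod_cast card_gaps_add (d := d) m s n
  have hg : (0 : ℝ) ≤ ((gaps d m s n).card : ℝ) := by positivity
  rw [Seminorm.mem_ball]
  -- Three errors: tile means against prescribed values, prescribed values against their target
  -- mean, and the corridor spins.
  have e : (N : ℝ) • (empMean (cube d n) σ - (((M * tileCount d m s n : ℕ) : ℝ) / N) • ybar) =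
      (M : ℝ) • (∑ j, (empMean (tile d m s n j) σ - v j)) + (M : ℝ) • (∑ j, v j - tileCount d m s n • ybar) +
        ∑ z ∈ gaps d m s n, σ z := by
    rw [smul_sub, smul_empMean_cube_eq m s n σ, smul_smul, mul_div_cancel₀ _ hN.ne',
      Finset.sum_sub_distrib, smul_sub, smul_sub, Nat.cast_mul, mul_smul, Nat.cast_smul_eq_nsmul ℝ (tileCount d m s n)]
    abel
  have hsum1 : p (∑ j, (empMean (tile d m s n j) σ - v j)) ≤ tileCount d m s n * η := by
    refine (Finset.le_sum_of_subadditive p (map_zero p).le (map_add_le_add p) _ _).trans ?_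
    refine (Finset.sum_le_sum fun j _ => ((p.mem_ball).1 (h₁ j)).le).trans ?_
    simp [tileCount]
  have hsum2 : p (∑ z ∈ gaps d m s n, σ z) ≤ (gaps d m s n).card * t := by
    refine (Finset.le_sum_of_subadditive p (map_zero p).le (map_add_le_add p) _ _).trans ?_
    refine (Finset.sum_le_sum fun j hj => ((p.mem_ball_zero).1 (h₂ j hj)).le).trans ?_
    simp
  have hp : N * p (empMean (cube d n) σ - (((M * tileCount d m s n : ℕ) : ℝ) / N) • ybar) ≤
      M * (tileCount d m s n * η) + M * (tileCount d m s n * δ) + (gaps d m s n).card * t := by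
    have h := map_smul_eq_mul p (N : ℝ) (empMean (cube d n) σ - (((M * tileCount d m s n : ℕ) : ℝ) / N) • ybar)
    rw [Real.norm_of_nonneg hN.le] at h
    rw [← h, e]
    refine (map_add_le_add p _ _).trans (add_le_add ((map_add_le_add p _ _).trans ?_) hsum2)
    rw [map_smul_eq_mul, map_smul_eq_mul, Real.norm_of_nonneg hM]
    exact add_le_add (mul_le_mul_of_nonneg_left hsum1 hM) (mul_le_mul_of_nonneg_left h₃ hM)
  have hr' : N * (η + δ) + (N - M * tileCount d m s n) * t < N * r := by
    have := mul_lt_mul_of_pos_left hr hN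
    refine lt_of_eq_of_lt ?_ this
    push_cast
    field_simp
  refine lt_of_mul_lt_mul_left (lt_of_le_of_lt (hp.trans ?_) hr') hN.le
  have : (tileCount d m s n * M : ℝ) ≤ N := by linarith
  have h5 := mul_le_mul_of_nonneg_right this (add_nonneg hη hδ)
  have h6 : ((gaps d m s n).card : ℝ) * t = (N - M * tileCount d m s n) * t := by
    rw [← hcard]; ring
  linarith

variable [MeasurableSpace X]

namespace InvariantSystem

variable (μ : InvariantSystem d X)

/-- `μ` satisfies the decoupling inequality at scale `m`, with distance `gm` and cost `cm`. -/
def DecoupledAt (m : ℕ+) (gm cm : ℝ) : Prop :=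
  ∀ (S : Finset (Fin d → ℤ)) (A B : Set (Config d X)),
    MeasurableSet[fieldSigma X (cube d m).sites] A →
    MeasurableSet[fieldSigma X S] B →
    (∀ s ∈ S, ∀ z ∈ (cube d m).sites, gm < dist s z) →
    ∀ Λ : LatticeBox d, (cube d m).sites ⊆ Λ.sites → S ⊆ Λ.sites →
      ENNReal.ofReal (Real.exp (-cm)) * μ.law Λ A * μ.law Λ B ≤ μ.law Λ (A ∩ B)

/-- The conditional probability that a spin lies in `E`, given the others, is at least `a`. -/
def SpinLowerBound (E : Set X) (a : ℝ) : Prop :=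
  ∀ Λ : LatticeBox d, (0 : Fin d → ℤ) ∈ Λ.sites → ∀ᵐ σ ∂(μ.law Λ),
    a ≤ μ.condProb Λ (fieldSigma X (Λ.sites.erase 0)) {η | η 0 ∈ E} σ

variable {μ}

theorem measurableSet_iInter_tile {m : ℕ+} {s : ℕ} {n : ℕ+}
    {A : Fin (tileCount d m s n) → Set X} (hA : ∀ j, MeasurableSet (A j))
    (J : Finset (Fin (tileCount d m s n))) :
    MeasurableSet[fieldSigma X (J.biUnion fun j => (tile d m s n j).sites)]
      (⋂ j ∈ J, empMean (tile d m s n j) ⁻¹' A j) :=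
  @Finset.measurableSet_biInter _ _ (fieldSigma X _) _ J fun j hj =>
    measurableSet_empMean_preimage (Finset.subset_biUnion_of_mem (fun j => (tile d m s n j).sites) hj)
      (hA j)

/-- Tiles are split off one at a time. Each is at distance more than `gm` from the union of those
already treated, so each costs one factor `exp (-cm)`. -/
theorem DecoupledAt.prod_le_tiles {m : ℕ+} {gm cm : ℝ} (h : μ.DecoupledAt m gm cm) {s : ℕ}
    (hs : gm < s + 1) {n : ℕ+} {A : Fin (tileCount d m s n) → Set X}
    (hA : ∀ j, MeasurableSet (A j)) (J : Finset (Fin (tileCount d m s n))) :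
    ENNReal.ofReal (Real.exp (-cm)) ^ J.card * ∏ j ∈ J, μ.cramer m (A j) ≤
      μ.law (cube d n) (⋂ j ∈ J, empMean (tile d m s n j) ⁻¹' A j) := by
  induction J using Finset.induction_on with
  | empty => simp [μ.law_univ]
  | insert j J hj ih =>
    rw [Finset.card_insert_of_notMem hj, Finset.prod_insert hj, Finset.set_biInter_insert]
    refine le_trans ?_ (μ.decoupled_translate h (sites_tile_subset j)
      (Finset.biUnion_subset.2 fun j _ => sites_tile_subset j) ?_ (hA j)
      (measurableSet_iInter_tile hA J))
    · calc _ = ENNReal.ofReal (Real.exp (-cm)) * μ.cramer m (A j) *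
            (ENNReal.ofReal (Real.exp (-cm)) ^ J.card * ∏ j ∈ J, μ.cramer m (A j)) := by ring
        _ ≤ _ := by gcongr
    · intro v hv w hw
      obtain ⟨j', hj', hv⟩ := Finset.mem_biUnion.1 hv
      exact hs.trans_le (lt_dist_of_mem_tile (by rintro rfl; exact hj hj') hv hw)

/-- Sites of `G` are added one at a time. The event already built does not involve the new site, so
the conditional bound applies and costs one factor `a`. -/
theorem SpinLowerBound.pow_mul_le {E : Set X} (hE : MeasurableSet E) {a : ℝ}
    (h : μ.SpinLowerBound E a) {Λ : LatticeBox d} {S G : Finset (Fin d → ℤ)} (hS : S ⊆ Λ.sites)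
    (hG : G ⊆ Λ.sites) (hd : Disjoint S G) {B : Set (Config d X)}
    (hB : MeasurableSet[fieldSigma X S] B) :
    ENNReal.ofReal a ^ G.card * μ.law Λ B ≤ μ.law Λ ((⋂ z ∈ G, {σ | σ z ∈ E}) ∩ B) := by
  induction G using Finset.induction_on with
  | empty => simp
  | insert z G hz ih =>
    rw [Finset.card_insert_of_notMem hz, Finset.set_biInter_insert, Set.inter_assoc, pow_succ',
      mul_assoc]
    rw [Finset.insert_subset_iff] at hG
    rw [Finset.disjoint_insert_right] at hd
    have hmeas : MeasurableSet[fieldSigma X (S ∪ G)] ((⋂ z ∈ G, {σ : Config d X | σ z ∈ E}) ∩ B) := by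
      refine @MeasurableSet.inter _ (fieldSigma X _) _ _ ?_
        (fieldSigma_mono Finset.subset_union_left _ hB)
      exact @Finset.measurableSet_biInter _ _ (fieldSigma X _) _ G fun w hw =>
        measurableSet_eval_preimage (Finset.mem_union_right _ hw) hE
    refine le_trans ?_ (μ.ofReal_mul_law_le_eval hE h hG.1 (Finset.union_subset hS hG.2) ?_ hmeas)
    · gcongr
      exact ih hG.2 hd.2
    · simp [hz, hd.1]

/-- Finite-volume lower bound: tile a large cube by cubes of side `m`, prescribe the tile means
and bound the spins in the gaps. -/
theorem DecoupledAt.le_cramer_ball {m : ℕ+} {gm cm : ℝ} (h : μ.DecoupledAt m gm cm) {s : ℕ}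
    (hs : gm < s + 1) {p : Seminorm ℝ X}
    (hmeas : ∀ (y : X) (r : ℝ), 0 < r → MeasurableSet (p.ball y r)) {t a : ℝ} (ht : 0 < t)
    (ha : μ.SpinLowerBound (p.ball 0 t) a) {n : ℕ+} {ι : Type*} {A : ι → Set X}
    (hA : ∀ i, MeasurableSet (A i)) {y : ι → X} {η δ r : ℝ} (hη : 0 ≤ η) (hδ : 0 ≤ δ) (hr₀ : 0 < r)
    (hAy : ∀ i, A i ⊆ p.ball (y i) η) {ybar : X}
    (F : Finset (Fin (tileCount d m s n) → ι))
    (hF : (F : Set (Fin (tileCount d m s n) → ι)).PairwiseDisjoint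
      fun f => Set.univ.pi fun j => A (f j))
    (hmean : ∀ f ∈ F, p (∑ j, y (f j) - (tileCount d m s n : ℕ) • ybar) ≤
      (tileCount d m s n : ℕ) * δ)
    (hr : η + δ + (1 - (((m : ℕ) ^ d * tileCount d m s n : ℕ) : ℝ) / ((n : ℕ) ^ d : ℕ)) * t
      < r) :
    ENNReal.ofReal a ^ (gaps d m s n).card *
      (ENNReal.ofReal (Real.exp (-cm)) ^ (tileCount d m s n) *
        ∑ f ∈ F, ∏ j, μ.cramer m (A (f j))) ≤
      μ.cramer n
        (p.ball (((((m : ℕ) ^ d * tileCount d m s n : ℕ) : ℝ) / ((n : ℕ) ^ d : ℕ)) • ybar) r)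
      := by
  let R : (Fin (tileCount d m s n) → ι) → Set (Config d X) := fun f =>
    ⋂ j ∈ (Finset.univ : Finset (Fin (tileCount d m s n))), empMean (tile d m s n j) ⁻¹' A (f j)
  have hR : ∀ f, MeasurableSet[fieldSigma X (Finset.univ.biUnion fun j => (tile d m s n j).sites)]
      (R f) := fun f => measurableSet_iInter_tile (fun j => hA (f j)) Finset.univ
  -- Disjointness lets the probabilities of all admissible prescriptions be added. The tilted lower
  -- bound needs this sum.
  have hdisj : (F : Set (Fin (tileCount d m s n) → ι)).PairwiseDisjoint R := by
    intro f hf f' hf' hne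
    have := hF hf hf' hne
    rw [Function.onFun, Set.disjoint_left] at this ⊢
    intro σ h1 h2
    refine this (a := fun j => empMean (tile d m s n j) σ) ?_ ?_
    · intro j _
      exact Set.mem_iInter₂.1 h1 j (Finset.mem_univ _)
    · intro j _
      exact Set.mem_iInter₂.1 h2 j (Finset.mem_univ _)
  have h1 : ENNReal.ofReal (Real.exp (-cm)) ^ tileCount d m s n * ∑ f ∈ F, ∏ j, μ.cramer m (A (f j)) ≤
      μ.law (cube d n) (⋃ f ∈ F, R f) := by
    rw [@measure_biUnion_finset _ _ (fieldSigma X _) _ _ _ hdisj fun f _ =>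
      fieldSigma_mono (biUnion_tile_subset m s n) _ (hR f), Finset.mul_sum]
    refine Finset.sum_le_sum fun f _ => ?_
    have := h.prod_le_tiles hs (n := n) (fun j => hA (f j)) Finset.univ
    simpa [R] using this
  rw [μ.cramer_apply n (hmeas _ _ hr₀)]
  rw [gaps]
  refine (mul_le_mul_right h1 _).trans ((ha.pow_mul_le (hmeas _ _ ht) (biUnion_tile_subset m s n)
    Finset.sdiff_subset Finset.disjoint_sdiff (@Finset.measurableSet_biUnion _ _ (fieldSigma X _) _ F
      fun f _ => hR f)).trans ?_)
  apply measure_mono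
  rintro σ ⟨hσ1, hσ2⟩
  obtain ⟨f, hf, hσ⟩ := Set.mem_iUnion₂.1 hσ2
  exact seminorm_empMean_cube_sub_lt p hη hδ
    (fun j => hAy (f j) (Set.mem_iInter₂.1 hσ j (Finset.mem_univ _)))
    (fun z hz => Set.mem_iInter₂.1 hσ1 z hz) (hmean f hf) hr

end InvariantSystem

end Tilings

/-! ### Passage to large cubes -/

section Asymptotics

open LatticeBox

theorem tendsto_natDiv_div_atTop (k : ℕ) :
    Tendsto (fun n : ℕ+ => (((n : ℕ) / k : ℕ) : ℝ) / ((n : ℕ) : ℝ)) atTop (𝓝 ((k : ℝ)⁻¹)) := by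
  have h := (tendsto_nat_floor_mul_div_atTop (R := ℝ) (a := (k : ℝ)⁻¹) (by positivity)).comp
    (tendsto_natCast_atTop_atTop.comp tendsto_PNat_val_atTop_atTop)
  refine h.congr fun n => ?_
  simp only [Function.comp]
  congr 2
  rw [inv_mul_eq_div]
  exact Nat.floor_div_eq_div _ _

theorem tendsto_tileCount_div_atTop (d : ℕ) (m : ℕ+) (s : ℕ) :
    Tendsto (fun n : ℕ+ => (((m : ℕ) ^ d * tileCount d m s n : ℕ) : ℝ) / ((n : ℕ) ^ d : ℕ)) atTop
      (𝓝 ((((m : ℕ) : ℝ) / ((m + s : ℕ) : ℝ)) ^ d)) := by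
  have h := ((tendsto_natDiv_div_atTop (m + s)).const_mul ((m : ℕ) : ℝ)).pow d
  rw [← div_eq_mul_inv] at h
  refine h.congr fun n => ?_
  push_cast
  rw [mul_pow, div_pow, mul_div_assoc]

theorem tendsto_tileCount_atTop {d : ℕ} (hd : 0 < d) (m : ℕ+) (s : ℕ) :
    Tendsto (fun n : ℕ+ => tileCount d m s n) atTop atTop :=
  (tendsto_pow_atTop hd.ne').comp
    ((Nat.tendsto_div_const_atTop (by have := m.pos; omega)).comp tendsto_PNat_val_atTop_atTop)

theorem tendsto_div_add_floor_pow {g : ℕ+ → ℝ} (hg : ∀ m, 0 ≤ g m)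
    (h : Tendsto (fun m : ℕ+ => g m / (m : ℝ)) atTop (𝓝 0)) (d : ℕ) :
    Tendsto (fun m : ℕ+ => (((m : ℕ) : ℝ) / ((m + ⌊g m⌋₊ : ℕ) : ℝ)) ^ d) atTop (𝓝 1) := by
  have h1 : Tendsto (fun m : ℕ+ => (⌊g m⌋₊ : ℝ) / (m : ℝ)) atTop (𝓝 0) := by
    refine squeeze_zero (fun m => by positivity) (fun m => ?_) h
    gcongr
    exact Nat.floor_le (hg m)
  have h2 : Tendsto (fun m : ℕ+ => (1 + (⌊g m⌋₊ : ℝ) / (m : ℝ))⁻¹ ^ d) atTop (𝓝 1) := by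
    have := ((h1.const_add 1).inv₀ (by norm_num)).pow d
    simpa using this
  refine h2.congr fun m => ?_
  have : (0 : ℝ) < ((m : ℕ) : ℝ) := by exact_mod_cast m.pos
  congr 1
  push_cast
  field_simp

variable {X : Type*} [AddCommGroup X] [Module ℝ X] {d : ℕ} [MeasurableSpace X]

namespace InvariantSystem

variable {μ : InvariantSystem d X}

/-- Asymptotic lower bound: if the independent tilings by cubes of side `m` with mean close to
`ybar` have exponential rate at least `R`, so has `μ`, up to a small error for `m` large. -/
theorem LowerAsymptoticallyDecoupled.eventually_le_cramer_ball (hdec : μ.LowerAsymptoticallyDecoupled)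
    (hd : 0 < d) {p : Seminorm ℝ X}
    (hmeas : ∀ (y : X) (r : ℝ), 0 < r → MeasurableSet (p.ball y r)) {t a : ℝ} (ht : 0 < t)
    (ha₀ : 0 < a) (ha : μ.SpinLowerBound (p.ball 0 t) a) {δ : ℝ} (hδ : 0 < δ) :
    ∀ᶠ m : ℕ+ in atTop, ∃ ρ : ℝ, 1 - δ ≤ ρ ∧ ρ ≤ 1 ∧
      ∀ {ι : Type} {A : ι → Set X} {y : ι → X} {ybar : X} {η R : ℝ},
        (∀ i, MeasurableSet (A i)) → 0 ≤ η → (∀ i, A i ⊆ p.ball (y i) η) →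
        (∀ᶠ T : ℕ in atTop, ∃ F : Finset (Fin T → ι),
          (F : Set (Fin T → ι)).PairwiseDisjoint (fun f => Set.univ.pi fun j => A (f j)) ∧
          (∀ f ∈ F, p (∑ j, y (f j) - T • ybar) ≤ T * δ) ∧
          ENNReal.ofReal (Real.exp (T * ((m : ℕ) ^ d : ℕ) * R)) ≤
            ∑ f ∈ F, ∏ j, μ.cramer m (A (f j))) →
        ∀ᶠ n : ℕ+ in atTop, ENNReal.ofReal (Real.exp (((n : ℕ) ^ d : ℕ) * (ρ * R - δ))) ≤
          μ.cramer n (p.ball (ρ • ybar) (η + 3 * δ)) := by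
  obtain ⟨g, c, hg, hc, hgm, hcm, h⟩ := hdec
  have hρ := tendsto_div_add_floor_pow hg hgm d
  have hcm' : Tendsto (fun m : ℕ+ => c m / ((m : ℕ) ^ d : ℕ)) atTop (𝓝 0) := by
    refine hcm.congr fun m => ?_
    rw [card_sites]; rfl
  -- For large `m`: corridor spins barely move the mean, the covered proportion is close to one, and
  -- the cost per site of corridors and decoupling is below `δ`. None of this involves the
  -- prescription, so `m` may later be chosen to suit the pressure as well.
  have e1 := (((hρ.const_sub 1).mul_const t).eventually_lt_const
    (show (1 - 1) * t < δ / 2 by rw [sub_self, zero_mul]; positivity))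
  have e2 := hρ.eventually_const_lt (show 1 - δ < 1 by linarith)
  have e3 := (((hρ.const_sub 1).mul_const (Real.log a)).sub (hcm'.mul hρ)).eventually_const_lt
    (show -δ < (1 - 1) * Real.log a - 0 * 1 by simp; positivity)
  filter_upwards [e1, e2, e3] with m h1 h2 h3
  have hm := h m
  -- The limiting proportion of sites covered by tiles as `n → ∞`.
  set ρ : ℝ := (((m : ℕ) : ℝ) / ((m + ⌊g m⌋₊ : ℕ) : ℝ)) ^ d with hρdef
  have hm0 : (0 : ℝ) < ((m : ℕ) : ℝ) := by exact_mod_cast m.pos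
  refine ⟨ρ, h2.le, ?_, ?_⟩
  · refine pow_le_one₀ (by positivity) ?_
    push_cast
    rw [div_le_one (by positivity)]
    linarith [show (0 : ℝ) ≤ ⌊g m⌋₊ by positivity]
  intro ι A y ybar η R hA hη hAy hF
  have hn := tendsto_tileCount_div_atTop d m ⌊g m⌋₊
  rw [← hρdef] at hn
  have f1 := ((hn.const_sub 1).mul_const t).eventually_lt_const h1
  have f2 := (((hn.sub_const ρ).abs).mul_const (p ybar)).eventually_lt_const
    (show |ρ - ρ| * p ybar < δ / 2 by simp; positivity)
  have f3 := ((((hn.const_sub 1).mul_const (Real.log a)).sub (hn.const_mul (c m / ((m : ℕ) ^ d : ℕ)))).add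
    (hn.mul_const R)).eventually_const_lt
    (show ρ * R - δ < (1 - ρ) * Real.log a - (c m / ((m : ℕ) ^ d : ℕ)) * ρ + ρ * R by linarith)
  filter_upwards [f1, f2, f3, (tendsto_tileCount_atTop hd m ⌊g m⌋₊).eventually hF] with n g1 g2 g3 g4
  obtain ⟨F, hF1, hF2, hF3⟩ := g4
  have key := DecoupledAt.le_cramer_ball (μ := μ) (m := m) (gm := g m) (cm := c m) hm
    (Nat.lt_floor_add_one (g m)) hmeas ht ha (n := n) hA hη hδ.le
    (show (0 : ℝ) < η + 5 / 2 * δ by positivity) hAy F hF1 hF2 (by linarith)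
  -- The remaining `δ / 2` pays for replacing the proportion covered at finite `n` by its limit `ρ`.
  have hsub : p.ball (((((m : ℕ) ^ d * tileCount d m ⌊g m⌋₊ n : ℕ) : ℝ) / ((n : ℕ) ^ d : ℕ)) • ybar)
      (η + 5 / 2 * δ) ⊆ p.ball (ρ • ybar) (η + 3 * δ) := by
    intro x hx
    rw [Seminorm.mem_ball] at hx ⊢
    set ρn := ((((m : ℕ) ^ d * tileCount d m ⌊g m⌋₊ n : ℕ) : ℝ) / ((n : ℕ) ^ d : ℕ))
    have : x - ρ • ybar = (x - ρn • ybar) + (ρn - ρ) • ybar := by module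
    rw [this]
    refine (map_add_le_add p _ _).trans_lt ?_
    rw [map_smul_eq_mul, Real.norm_eq_abs]
    linarith
  refine le_trans ?_ (key.trans (measure_mono hsub))
  set T := tileCount d m ⌊g m⌋₊ n
  set G := (gaps d m ⌊g m⌋₊ n).card
  have hcard : (G : ℝ) + T * ((m : ℕ) ^ d : ℕ) = ((n : ℕ) ^ d : ℕ) := by
    exact_mod_cast card_gaps_add (d := d) m ⌊g m⌋₊ n
  have hN : (0 : ℝ) < ((n : ℕ) ^ d : ℕ) := by
    have : 0 < (n : ℕ) ^ d := by positivity
    exact_mod_cast this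
  have hM : (0 : ℝ) < ((m : ℕ) ^ d : ℕ) := by
    have : 0 < (m : ℕ) ^ d := by positivity
    exact_mod_cast this
  calc ENNReal.ofReal (Real.exp (((n : ℕ) ^ d : ℕ) * (ρ * R - δ)))
      ≤ ENNReal.ofReal (Real.exp (G * Real.log a + (T * (-c m) + T * ((m : ℕ) ^ d : ℕ) * R))) := by
        apply ENNReal.ofReal_le_ofReal
        apply Real.exp_le_exp.2
        have := mul_le_mul_of_nonneg_left g3.le hN.le
        refine this.trans (le_of_eq ?_)
        rw [Nat.cast_mul]
        have hG : (G : ℝ) = ((n : ℕ) ^ d : ℕ) - T * ((m : ℕ) ^ d : ℕ) := by linarith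
        rw [hG]
        field_simp
        ring
    _ = ENNReal.ofReal a ^ G * (ENNReal.ofReal (Real.exp (-c m)) ^ T *
          ENNReal.ofReal (Real.exp (T * ((m : ℕ) ^ d : ℕ) * R))) := by
        rw [Real.exp_add, Real.exp_add, Real.exp_nat_mul, Real.exp_nat_mul, Real.exp_log ha₀,
          ENNReal.ofReal_mul (by positivity), ENNReal.ofReal_mul (by positivity),
          ENNReal.ofReal_pow ha₀.le, ENNReal.ofReal_pow (by positivity)]
    _ ≤ _ := by gcongr

end InvariantSystem

end Asymptotics

/-! ### Weak law and Cramér lower bound for finitely many atoms -/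

section FiniteLargeDeviations

variable {ι : Type*} [Fintype ι]

theorem Fin.sum_pi_succ {M : Type*} [AddCommMonoid M] {T : ℕ} (φ : (Fin (T + 1) → ι) → M) :
    ∑ f, φ f = ∑ i, ∑ f : Fin T → ι, φ (Fin.cons i f) := by
  rw [← Fintype.sum_prod_type']
  exact (Fintype.sum_equiv (Fin.consEquiv fun _ => ι) _ _ fun x => rfl).symm

theorem sum_prod_weights {w : ι → ℝ} (hw : ∑ i, w i = 1) (T : ℕ) :
    ∑ f : Fin T → ι, ∏ j, w (f j) = 1 := by
  rw [← Fintype.sum_pow, hw, one_pow]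

theorem sum_prod_weights_mul_sum {w φ : ι → ℝ} (hw : ∑ i, w i = 1) (hφ : ∑ i, w i * φ i = 0)
    (T : ℕ) : ∑ f : Fin T → ι, (∏ j, w (f j)) * ∑ j, φ (f j) = 0 := by
  induction T with
  | zero => simp
  | succ T ih =>
    rw [Fin.sum_pi_succ]
    simp only [Fin.prod_univ_succ, Fin.sum_univ_succ, Fin.cons_zero, Fin.cons_succ]
    have : ∀ i, ∑ f : Fin T → ι, w i * (∏ j, w (f j)) * (φ i + ∑ j, φ (f j)) = w i * φ i := by
      intro i
      calc _ = w i * φ i * ∑ f : Fin T → ι, ∏ j, w (f j) +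
            w i * ∑ f : Fin T → ι, (∏ j, w (f j)) * ∑ j, φ (f j) := by
            rw [Finset.mul_sum, Finset.mul_sum, ← Finset.sum_add_distrib]
            exact Finset.sum_congr rfl fun f _ => by ring
        _ = _ := by rw [ih, sum_prod_weights hw]; ring
    rw [Finset.sum_congr rfl fun i _ => this i, hφ]

/-- The variance of a sum of independent centred variables. -/
theorem sum_prod_weights_mul_sum_sq {w φ : ι → ℝ} (hw : ∑ i, w i = 1)
    (hφ : ∑ i, w i * φ i = 0) (T : ℕ) :
    ∑ f : Fin T → ι, (∏ j, w (f j)) * (∑ j, φ (f j)) ^ 2 = T * ∑ i, w i * φ i ^ 2 := by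
  induction T with
  | zero => simp
  | succ T ih =>
    rw [Fin.sum_pi_succ]
    simp only [Fin.prod_univ_succ, Fin.sum_univ_succ, Fin.cons_zero, Fin.cons_succ]
    have : ∀ i, ∑ f : Fin T → ι, w i * (∏ j, w (f j)) * (φ i + ∑ j, φ (f j)) ^ 2 =
        w i * φ i ^ 2 + w i * (T * ∑ i, w i * φ i ^ 2) := by
      intro i
      calc _ = w i * φ i ^ 2 * ∑ f : Fin T → ι, ∏ j, w (f j) +
            2 * w i * φ i * (∑ f : Fin T → ι, (∏ j, w (f j)) * ∑ j, φ (f j)) +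
            w i * ∑ f : Fin T → ι, (∏ j, w (f j)) * (∑ j, φ (f j)) ^ 2 := by
            rw [Finset.mul_sum, Finset.mul_sum, Finset.mul_sum, ← Finset.sum_add_distrib,
              ← Finset.sum_add_distrib]
            exact Finset.sum_congr rfl fun f _ => by ring
        _ = _ := by rw [ih, sum_prod_weights hw, sum_prod_weights_mul_sum hw hφ]; ring
    rw [Finset.sum_congr rfl fun i _ => this i, Finset.sum_add_distrib, ← Finset.sum_mul, hw]
    push_cast
    ring

variable {X : Type*} [AddCommGroup X] [Module ℝ X]

/-- The weak law of large numbers for finitely supported laws, in a seminormed space. -/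
theorem eventually_half_le_sum_prod_weights {w : ι → ℝ} (hw₀ : ∀ i, 0 ≤ w i)
    (hw : ∑ i, w i = 1) (y : ι → X) (p : Seminorm ℝ X) {δ : ℝ} (hδ : 0 < δ) :
    ∀ᶠ T : ℕ in atTop, ∃ F : Finset (Fin T → ι),
      (∀ f ∈ F, p (∑ j, y (f j) - T • ∑ i, w i • y i) ≤ T * δ) ∧
      1 / 2 ≤ ∑ f ∈ F, ∏ j, w (f j) := by
  classical
  have hp : 0 ≤ ∑ i, p (y i) := Finset.sum_nonneg fun i _ => apply_nonneg p _
  set κ : ℝ := δ / (1 + ∑ i, p (y i)) with hκ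
  have hκ0 : 0 < κ := by positivity
  -- Deviations of the vector sum are controlled by those of the counts of each index, which are
  -- scalar. Chebyshev's inequality then needs nothing of `X` beyond a seminorm.
  let φ : ι → ι → ℝ := fun i k => (if k = i then 1 else 0) - w i
  have hφ : ∀ i, ∑ k, w k * φ i k = 0 := by
    intro i
    simp [φ, mul_sub, Finset.sum_sub_distrib, ← Finset.sum_mul, hw]
  have hw1 : ∀ i, w i ≤ 1 := fun i => hw ▸ Finset.single_le_sum (fun i _ => hw₀ i) (Finset.mem_univ i)
  have hφ2 : ∀ i, ∑ k, w k * φ i k ^ 2 ≤ 1 := by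
    intro i
    refine le_of_le_of_eq (Finset.sum_le_sum fun k _ => ?_) hw
    refine mul_le_of_le_one_right (hw₀ k) ?_
    rw [sq_le_one_iff_abs_le_one, abs_le]
    have := hw₀ i
    have := hw1 i
    simp only [φ]
    split_ifs <;> constructor <;> linarith
  -- From here on the Chebyshev bound `card ι * T / (T * κ) ^ 2` for the bad sequences is at most `1
  -- / 2`.
  have hlarge := tendsto_natCast_atTop_atTop (R := ℝ) |>.eventually_ge_atTop
    (2 * (Fintype.card ι : ℝ) / κ ^ 2)
  filter_upwards [hlarge, eventually_gt_atTop 0] with T hT hT0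
  have hT0' : (0 : ℝ) < T := by exact_mod_cast hT0
  have hW : ∀ f : Fin T → ι, 0 ≤ ∏ j, w (f j) := fun f => Finset.prod_nonneg fun j _ => hw₀ _
  refine ⟨Finset.univ.filter fun f => p (∑ j, y (f j) - T • ∑ i, w i • y i) ≤ T * δ,
    fun f hf => (Finset.mem_filter.1 hf).2, ?_⟩
  have hbad : ∀ f : Fin T → ι, ¬ p (∑ j, y (f j) - T • ∑ i, w i • y i) ≤ T * δ →
      (T * κ) ^ 2 ≤ ∑ i, (∑ j, φ i (f j)) ^ 2 := by
    intro f hf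
    have hex : ∃ i, T * κ ≤ |∑ j, φ i (f j)| := by
      by_contra! hlt
      apply hf
      have e : ∑ j, y (f j) - T • ∑ i, w i • y i = ∑ i, (∑ j, φ i (f j)) • y i := by
        simp only [φ, Finset.sum_smul, sub_smul, Finset.sum_sub_distrib]
        rw [Finset.sum_comm]
        simp [ite_smul, Finset.smul_sum]
      rw [e]
      calc p (∑ i, (∑ j, φ i (f j)) • y i) ≤ ∑ i, p ((∑ j, φ i (f j)) • y i) :=
            Finset.le_sum_of_subadditive p (map_zero p).le (map_add_le_add p) _ _
        _ ≤ ∑ i, T * κ * p (y i) := by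
            refine Finset.sum_le_sum fun i _ => ?_
            rw [map_smul_eq_mul, Real.norm_eq_abs]
            exact mul_le_mul_of_nonneg_right (hlt i).le (apply_nonneg p _)
        _ = T * (κ * ∑ i, p (y i)) := by rw [← Finset.mul_sum, mul_assoc]
        _ ≤ T * δ := by
            refine mul_le_mul_of_nonneg_left ?_ hT0'.le
            rw [hκ, div_mul_eq_mul_div, div_le_iff₀ (by positivity)]
            nlinarith
    obtain ⟨i, hi⟩ := hex
    refine le_trans ?_ (Finset.single_le_sum (f := fun i => (∑ j, φ i (f j)) ^ 2)
      (fun i _ => sq_nonneg _) (Finset.mem_univ i))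
    rw [← sq_abs (∑ j, φ i (f j))]
    gcongr
  have hsum := Finset.sum_filter_add_sum_filter_not Finset.univ
    (fun f : Fin T → ι => p (∑ j, y (f j) - T • ∑ i, w i • y i) ≤ T * δ) fun f => ∏ j, w (f j)
  rw [sum_prod_weights hw] at hsum
  have hsmall : (∑ f ∈ Finset.univ.filter fun f : Fin T → ι =>
      ¬ p (∑ j, y (f j) - T • ∑ i, w i • y i) ≤ T * δ, ∏ j, w (f j)) * (T * κ) ^ 2 ≤
      Fintype.card ι * T := by
    calc _ ≤ ∑ f : Fin T → ι, (∏ j, w (f j)) * ∑ i, (∑ j, φ i (f j)) ^ 2 := by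
          rw [Finset.sum_mul]
          refine (Finset.sum_le_sum fun f hf => mul_le_mul_of_nonneg_left
            (hbad f (Finset.mem_filter.1 hf).2) (hW f)).trans ?_
          exact Finset.sum_le_sum_of_subset_of_nonneg (Finset.filter_subset _ _) fun f _ _ =>
            mul_nonneg (hW f) (Finset.sum_nonneg fun i _ => sq_nonneg _)
      _ = ∑ i, T * ∑ k, w k * φ i k ^ 2 := by
          simp_rw [Finset.mul_sum]
          rw [Finset.sum_comm]
          refine Finset.sum_congr rfl fun i _ => ?_
          rw [sum_prod_weights_mul_sum_sq hw (hφ i), Finset.mul_sum]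
      _ ≤ ∑ i : ι, (T : ℝ) := Finset.sum_le_sum fun i _ =>
          mul_le_of_le_one_right hT0'.le (hφ2 i)
      _ = _ := by simp
  rw [div_le_iff₀ (by positivity)] at hT
  set bad := ∑ f ∈ Finset.univ.filter fun f : Fin T → ι =>
      ¬ p (∑ j, y (f j) - T • ∑ i, w i • y i) ≤ T * δ, ∏ j, w (f j)
  have : bad ≤ 1 / 2 := by
    by_contra! hlt
    have h1 : 1 / 2 * (T * κ) ^ 2 < bad * (T * κ) ^ 2 := by gcongr
    have h2 : (Fintype.card ι : ℝ) * T ≤ 1 / 2 * (T * κ) ^ 2 := by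
      calc (Fintype.card ι : ℝ) * T = 1 / 2 * (2 * Fintype.card ι) * T := by ring
        _ ≤ 1 / 2 * (T * κ ^ 2) * T := by gcongr
        _ = _ := by ring
    linarith
  linarith

/-- The lower bound of Cramér's theorem for a finitely supported law, by exponential tilting. -/
theorem exists_eventually_tilted_lower_bound {w : ι → ℝ} (hw₀ : ∀ i, 0 ≤ w i) (y : ι → X)
    (p : Seminorm ℝ X) (l : X →ₗ[ℝ] ℝ) {M : ℝ} (hM : 0 < M)
    (hZ : 0 < ∑ i, w i * Real.exp (M * l (y i))) {δ : ℝ} (hδ : 0 < δ) :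
    ∃ ybar : X, ∀ᶠ T : ℕ in atTop, ∃ F : Finset (Fin T → ι),
      (∀ f ∈ F, p (∑ j, y (f j) - T • ybar) ≤ T * δ) ∧
      (∑ i, w i * Real.exp (M * l (y i))) ^ T * Real.exp (-(T * M * (l ybar + 2 * δ))) ≤
        ∑ f ∈ F, ∏ j, w (f j) := by
  set Z := ∑ i, w i * Real.exp (M * l (y i)) with hZdef
  let v : ι → ℝ := fun i => w i * Real.exp (M * l (y i)) / Z
  have hv₀ : ∀ i, 0 ≤ v i := fun i => div_nonneg (mul_nonneg (hw₀ i) (Real.exp_pos _).le) hZ.le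
  have hv : ∑ i, v i = 1 := by rw [← Finset.sum_div, ← hZdef, div_self hZ.ne']
  refine ⟨∑ i, v i • y i, ?_⟩
  -- The factor `1 / 2` of the weak law is absorbed here, which is why the exponent has `2 * δ`
  -- rather than `δ`.
  have hhalf : ∀ᶠ T : ℕ in atTop, Real.exp (-(T * (M * δ))) ≤ 1 / 2 := by
    have : Tendsto (fun T : ℕ => Real.exp (-(T * (M * δ)))) atTop (𝓝 0) :=
      Real.tendsto_exp_neg_atTop_nhds_zero.comp
        (tendsto_natCast_atTop_atTop.atTop_mul_const (by positivity))
    exact this.eventually_le_const (by norm_num)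
  -- The seminorm `p + |l|` controls the position and the tilting density together.
  filter_upwards [eventually_half_le_sum_prod_weights hv₀ hv y (p + l.toSeminorm) hδ, hhalf]
    with T hT hT2
  obtain ⟨F, hF1, hF2⟩ := hT
  set ybar := ∑ i, v i • y i
  refine ⟨F, fun f hf => le_trans ?_ (hF1 f hf), ?_⟩
  · rw [_root_.add_apply]
    exact le_add_of_nonneg_right (apply_nonneg _ _)
  have hterm : ∀ f ∈ F, Z ^ T * Real.exp (-(T * M * (l ybar + δ))) * ∏ j, v (f j) ≤
      ∏ j, w (f j) := by
    intro f hf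
    have h1 : l (∑ j, y (f j)) ≤ T * (l ybar + δ) := by
      have := hF1 f hf
      rw [_root_.add_apply] at this
      have h2 : |l (∑ j, y (f j)) - T * l ybar| ≤ T * δ := by
        have h3 : l.toSeminorm (∑ j, y (f j) - T • ybar) = |l (∑ j, y (f j)) - T * l ybar| := by
          rw [LinearMap.toSeminorm_apply, map_sub, map_nsmul, Real.norm_eq_abs, nsmul_eq_mul]
        rw [← h3]
        exact le_trans (le_add_of_nonneg_left (apply_nonneg _ _)) this
      have := (abs_le.1 h2).2
      linarith
    have h2 : ∏ j, v (f j) = (∏ j, w (f j)) * Real.exp (M * l (∑ j, y (f j))) / Z ^ T := by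
      simp only [v]
      rw [Finset.prod_div_distrib, Finset.prod_mul_distrib, ← Real.exp_sum, ← Finset.mul_sum,
        map_sum]
      simp
    rw [h2]
    have h3 : Z ^ T * Real.exp (-(T * M * (l ybar + δ))) *
        ((∏ j, w (f j)) * Real.exp (M * l (∑ j, y (f j))) / Z ^ T) =
        (∏ j, w (f j)) * Real.exp (M * l (∑ j, y (f j)) - T * M * (l ybar + δ)) := by
      rw [sub_eq_add_neg, Real.exp_add]
      field_simp
    rw [h3]
    refine mul_le_of_le_one_right (Finset.prod_nonneg fun j _ => hw₀ _) ?_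
    rw [Real.exp_le_one_iff]
    have := mul_le_mul_of_nonneg_left h1 hM.le
    linarith
  calc Z ^ T * Real.exp (-(T * M * (l ybar + 2 * δ)))
      = Z ^ T * Real.exp (-(T * M * (l ybar + δ))) * Real.exp (-(T * (M * δ))) := by
        rw [mul_assoc (Z ^ T), ← Real.exp_add]
        congr 2
        ring
    _ ≤ Z ^ T * Real.exp (-(T * M * (l ybar + δ))) * ∑ f ∈ F, ∏ j, v (f j) := by
        gcongr
        exact hT2.trans hF2
    _ ≤ _ := by
        rw [Finset.mul_sum]
        exact Finset.sum_le_sum hterm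

end FiniteLargeDeviations

/-! ### Discretisation, and the set of attained rates -/

section RateSets

open LatticeBox

section Integrals

/-- The integral may be infinite. A simple function below the integrand, of finite integral still
above `L`, has an absolutely continuous integral, so sets of small measure may be discarded. -/
theorem exists_lt_setLIntegral_of_lt_lintegral {Ω : Type*} [MeasurableSpace Ω] {P : Measure Ω}
    [IsFiniteMeasure P] {φ : Ω → ℝ} {L : ℝ≥0∞} (h : L < ∫⁻ x, ENNReal.ofReal (φ x) ∂P) :
    ∃ δ > 0, ∀ U, MeasurableSet U → P Uᶜ < δ → L < ∫⁻ x in U, ENNReal.ofReal (φ x) ∂P := by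
  obtain ⟨g, hg, hgt, hL⟩ := exists_lt_lintegral_simpleFunc_of_lt_lintegral
    (f := fun x => (φ x).toNNReal) h
  obtain ⟨δ, hδ, H⟩ := exists_pos_setLIntegral_lt_of_measure_lt hgt.ne
    (tsub_pos_of_lt hL).ne'
  refine ⟨δ, hδ, fun U hU hPU => ?_⟩
  have h1 := H _ hPU
  have h2 := lintegral_add_compl (μ := P) (fun x => (g x : ℝ≥0∞)) hU
  refine lt_of_lt_of_le ?_ (lintegral_mono (μ := P.restrict U) fun x =>
    ENNReal.coe_le_coe.2 (hg x) : ∫⁻ x in U, (g x : ℝ≥0∞) ∂P ≤ _)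
  by_contra! hle
  have : ∫⁻ x, (g x : ℝ≥0∞) ∂P < ∫⁻ x, (g x : ℝ≥0∞) ∂P := by
    calc ∫⁻ x, (g x : ℝ≥0∞) ∂P = ∫⁻ x in U, (g x : ℝ≥0∞) ∂P + ∫⁻ x in Uᶜ, (g x : ℝ≥0∞) ∂P := h2.symm
      _ < L + (∫⁻ x, (g x : ℝ≥0∞) ∂P - L) := ENNReal.add_lt_add_of_le_of_lt
          (ne_top_of_le_ne_top hL.ne_top hle) hle h1
      _ = _ := add_tsub_cancel_of_le hL.le
  exact this.false

variable {X : Type*} [AddCommGroup X] [Module ℝ X] [MeasurableSpace X]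

/-- Discretisation of an exponential integral for a law which is almost carried by finite unions
of balls. -/
theorem exists_finite_partition_exp_sum {P : Measure X} [IsFiniteMeasure P] {p : Seminorm ℝ X}
    (hmeas : ∀ y : X, MeasurableSet (p.ball y 1))
    (htight : ∀ γ : ℝ, 0 < γ → ∃ S : Finset X, P (⋃ y ∈ S, p.ball y 1)ᶜ ≤ ENNReal.ofReal γ)
    {l : X →ₗ[ℝ] ℝ} {ε : ℝ} (hl : ∀ x ∈ p.ball 0 1, l x ≤ ε) {M b : ℝ} (hM : 0 ≤ M)
    (h : ENNReal.ofReal (Real.exp (M * b)) < ∫⁻ x, ENNReal.ofReal (Real.exp (M * l x)) ∂P) :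
    ∃ (k : ℕ) (y : Fin k → X) (A : Fin k → Set X), (∀ i, MeasurableSet (A i)) ∧
      Pairwise (Function.onFun Disjoint A) ∧ (∀ i, A i ⊆ p.ball (y i) 1) ∧
      Real.exp (M * (b - ε)) ≤ ∑ i, (P (A i)).toReal * Real.exp (M * l (y i)) := by
  obtain ⟨δ, hδ, H⟩ := exists_lt_setLIntegral_of_lt_lintegral h
  obtain ⟨γ, hγ, hγδ⟩ : ∃ γ : ℝ, 0 < γ ∧ ENNReal.ofReal γ < δ := by
    obtain ⟨γ, h1, h2⟩ := ENNReal.lt_iff_exists_real_btwn.1 hδ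
    exact ⟨γ, ENNReal.ofReal_pos.1 h2.1, h2.2⟩
  obtain ⟨S, hS⟩ := htight γ hγ
  let e := S.equivFin.symm
  let y : Fin S.card → X := fun i => e i
  let A : Fin S.card → Set X := disjointed fun i => p.ball (y i) 1
  have hA : ∀ i, MeasurableSet (A i) := by
    intro i
    simp only [A, disjointed_eq_inter_compl]
    exact (hmeas _).inter (MeasurableSet.iInter fun j => MeasurableSet.iInter fun _ =>
      (hmeas _).compl)
  have hAy : ∀ i, A i ⊆ p.ball (y i) 1 := fun i => disjointed_subset _ i
  have hdisj : Pairwise (Function.onFun Disjoint A) := disjoint_disjointed _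
  have hU : (⋃ z ∈ S, p.ball z 1) = ⋃ i, A i := by
    rw [iUnion_disjointed]
    ext x
    simp only [Set.mem_iUnion, exists_prop]
    constructor
    · rintro ⟨z, hz, hx⟩
      exact ⟨S.equivFin ⟨z, hz⟩, by simpa [y, e] using hx⟩
    · rintro ⟨i, hx⟩
      exact ⟨y i, (e i).2, hx⟩
  refine ⟨S.card, y, A, hA, hdisj, hAy, ?_⟩
  rw [hU] at hS
  have h1 := H _ (MeasurableSet.iUnion hA) (hS.trans_lt hγδ)
  have h2 : ∫⁻ x in ⋃ i, A i, ENNReal.ofReal (Real.exp (M * l x)) ∂P ≤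
      ∑ i, P (A i) * ENNReal.ofReal (Real.exp (M * (l (y i) + ε))) := by
    rw [lintegral_iUnion hA hdisj, tsum_fintype]
    refine Finset.sum_le_sum fun i _ => ?_
    rw [mul_comm, ← setLIntegral_const]
    refine setLIntegral_mono' (hA i) fun x hx => ENNReal.ofReal_le_ofReal (Real.exp_le_exp.2 ?_)
    refine mul_le_mul_of_nonneg_left ?_ hM
    have := hl (x - y i) (by simpa [Seminorm.mem_ball] using hAy i hx)
    rw [map_sub] at this
    linarith
  have h3 : ∑ i, P (A i) * ENNReal.ofReal (Real.exp (M * (l (y i) + ε))) =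
      ENNReal.ofReal ((∑ i, (P (A i)).toReal * Real.exp (M * l (y i))) * Real.exp (M * ε)) := by
    rw [Finset.sum_mul, ENNReal.ofReal_sum_of_nonneg fun i _ => by positivity]
    refine Finset.sum_congr rfl fun i _ => ?_
    rw [mul_assoc, ← Real.exp_add, ENNReal.ofReal_mul ENNReal.toReal_nonneg,
      ENNReal.ofReal_toReal (measure_ne_top _ _), mul_add]
  rw [h3] at h2
  have h4 := (ENNReal.ofReal_lt_ofReal_iff_of_nonneg (Real.exp_pos _).le).1 (h1.trans_le h2)
  rw [mul_sub, Real.exp_sub, div_le_iff₀ (Real.exp_pos _)]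
  exact h4.le

end Integrals

theorem ofReal_exp_lt_iff {c : ℝ≥0∞} {N : ℕ} (hN : 0 < N) {b : ℝ} :
    ENNReal.ofReal (Real.exp (N * b)) < c ↔ (b : EReal) < ENNReal.log c / (N : EReal) := by
  have hN' : (0 : EReal) < (N : EReal) := by exact_mod_cast hN
  rw [EReal.lt_div_iff hN' (EReal.natCast_ne_top N), ← ENNReal.log_lt_log_iff,
    ENNReal.log_ofReal_of_pos (Real.exp_pos _), Real.log_exp, mul_comm]
  norm_cast

theorem ofReal_exp_le_iff {c : ℝ≥0∞} {N : ℕ} (hN : 0 < N) {b : ℝ} :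
    ENNReal.ofReal (Real.exp (N * b)) ≤ c ↔ (b : EReal) ≤ ENNReal.log c / (N : EReal) := by
  have hN' : (0 : EReal) < (N : EReal) := by exact_mod_cast hN
  rw [EReal.le_div_iff_mul_le hN' (EReal.natCast_ne_top N), ← ENNReal.log_le_log_iff,
    ENNReal.log_ofReal_of_pos (Real.exp_pos _), Real.log_exp, mul_comm]
  norm_cast

variable {X : Type*} [AddCommGroup X] [Module ℝ X] {d : ℕ} [MeasurableSpace X]

namespace InvariantSystem

variable {μ : InvariantSystem d X}

theorem LocallyControlled.exists_spinLowerBound [TopologicalSpace X] {C₀ : Set (Set X)}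
    (hX : IsMeasurableLCS C₀) (h : μ.LocallyControlled) {p : Seminorm ℝ X} (hp : p.ball 0 1 ∈ C₀) :
    ∃ t > 0, ∃ a > 0, μ.SpinLowerBound (p.ball 0 t) a := by
  obtain ⟨t, α, H⟩ := h
  obtain ⟨ht, hα, H⟩ := H _ (hX.subset hp)
  refine ⟨t _, ht, α _, hα, fun Λ hΛ => ?_⟩
  have := H Λ Λ subset_rfl hΛ
  rwa [Seminorm.smul_ball_zero ht.ne', Real.norm_eq_abs, abs_of_pos ht, mul_one] at this

theorem SpinLowerBound.law_compl_le {K : Set X} (hK : MeasurableSet K) {γ : ℝ}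
    (h : μ.SpinLowerBound K (1 - γ)) {Λ : LatticeBox d} {z : Fin d → ℤ}
    (hz : z ∈ Λ.sites) : μ.law Λ {σ | σ z ∈ K}ᶜ ≤ ENNReal.ofReal γ := by
  have h1 := μ.ofReal_mul_law_le_eval hK h hz (Finset.empty_subset _) (Finset.notMem_empty z)
    (B := Set.univ) (@MeasurableSet.univ _ (fieldSigma X ∅))
  rw [μ.law_univ, mul_one, Set.inter_univ] at h1
  rw [@prob_compl_eq_one_sub _ (fieldSigma X Λ.sites) _ _ (μ.isProbabilityMeasure_law Λ)
    (measurableSet_eval_preimage hz hK), tsub_le_iff_left]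
  calc (1 : ℝ≥0∞) = ENNReal.ofReal ((1 - γ) + γ) := by simp
    _ ≤ ENNReal.ofReal (1 - γ) + ENNReal.ofReal γ := ENNReal.ofReal_add_le
    _ ≤ _ := by gcongr

/-- Each law of the Cramér sequence is almost carried by finite unions of balls. -/
theorem exists_finset_cramer_compl_le [TopologicalSpace X] {D : Set X}
    (h_carried : μ.CarriedBy (fieldsIn d D)) (h_tight : μ.LocallyConvexTight D)
    {p : Seminorm ℝ X} (hp : ∀ y, p.ball y 1 ∈ 𝓝 y) (hmeas : ∀ y : X, MeasurableSet (p.ball y 1))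
    (m : ℕ+) {γ : ℝ} (hγ : 0 < γ) :
    ∃ S : Finset X, μ.cramer m (⋃ y ∈ S, p.ball y 1)ᶜ ≤ ENNReal.ofReal γ := by
  have hM : 0 < (cube d m).sites.card := card_sites_pos _
  have hM' : (0 : ℝ) < (cube d m).sites.card := by exact_mod_cast hM
  -- Dividing by the number of sites prepares a union bound over them.
  obtain ⟨K, hK, hKconv, hKcomp, hKp⟩ := h_tight (γ / (cube d m).sites.card) (by positivity)
  obtain ⟨S, -, hS⟩ := hKcomp.elim_nhds_subcover (fun y => p.ball y 1) fun y _ => hp y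
  refine ⟨S, ?_⟩
  set U := ⋃ y ∈ S, p.ball y 1
  have hU : MeasurableSet U := Finset.measurableSet_biUnion S fun y _ => hmeas y
  rw [μ.cramer_apply m hU.compl]
  let E : Set (Config d X) := ⋂ z ∈ (cube d m).sites, {σ | σ z ∈ K}
  have hE : MeasurableSet[fieldSigma X (cube d m).sites] E :=
    @Finset.measurableSet_biInter _ _ (fieldSigma X _) _ _ fun z hz =>
      measurableSet_eval_preimage hz hK
  have hUE : MeasurableSet[fieldSigma X (cube d m).sites]
      (empMean (cube d m) ⁻¹' Uᶜ ∩ E : Set (Config d X)) :=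
    @MeasurableSet.inter _ (fieldSigma X _) _ _
      (measurableSet_empMean_preimage subset_rfl hU.compl) hE
  have hzero : μ.law (cube d m) (empMean (cube d m) ⁻¹' Uᶜ ∩ E) = 0 := by
    -- `D^{ℤ^d}` need not be measurable, so the event is compared with `∅` on it: there all spins
    -- lie in the convex set `K ∩ D`, hence so does their mean, which cannot then leave `U`.
    rw [h_carried (cube d m) _ ∅ hUE (@MeasurableSet.empty _ (fieldSigma X _)) ?_, measure_empty]
    rw [Set.empty_inter]
    ext σ
    simp only [Set.mem_inter_iff, Set.mem_empty_iff_false, iff_false]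
    rintro ⟨⟨h1, h2⟩, h3⟩
    apply h1
    apply hS
    apply subset_closure
    rw [empMean, Finset.smul_sum]
    refine hKconv.sum_mem (fun _ _ => by positivity) ?_ fun z hz =>
      ⟨Set.mem_iInter₂.1 h2 z hz, h3 z⟩
    rw [Finset.sum_const, nsmul_eq_mul, mul_inv_cancel₀ hM'.ne']
  have hsub : (empMean (cube d m) ⁻¹' Uᶜ : Set (Config d X)) ⊆
      (empMean (cube d m) ⁻¹' Uᶜ ∩ E) ∪ ⋃ z ∈ (cube d m).sites, {σ | σ z ∈ K}ᶜ := by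
    intro σ hσ
    by_cases hσE : σ ∈ E
    · exact Or.inl ⟨hσ, hσE⟩
    · right
      simpa [E] using hσE
  calc μ.law (cube d m) (empMean (cube d m) ⁻¹' Uᶜ)
      ≤ 0 + ∑ z ∈ (cube d m).sites, μ.law (cube d m) {σ | σ z ∈ K}ᶜ := by
        refine (measure_mono hsub).trans ((measure_union_le _ _).trans ?_)
        rw [hzero]
        gcongr
        exact measure_biUnion_finset_le _ _
    _ ≤ 0 + ∑ z ∈ (cube d m).sites, ENNReal.ofReal (γ / (cube d m).sites.card) := by
        gcongr with z hz
        exact SpinLowerBound.law_compl_le hK hKp hz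
    _ = ENNReal.ofReal γ := by
        rw [zero_add, Finset.sum_const, nsmul_eq_mul, ← ENNReal.ofReal_natCast,
          ← ENNReal.ofReal_mul (by positivity), mul_div_cancel₀ _ hM'.ne']

/-- The pairs `(y, r)` such that the open unit ball around `y`, slightly shrunk, has exponential
rate larger than `r`. -/
def rateSet (μ : InvariantSystem d X) (p : Seminorm ℝ X) : Set (X × ℝ) :=
  {q | ∃ η : ℝ, 0 < η ∧ η < 1 ∧ ∃ ε > 0, ∀ᶠ n : ℕ+ in atTop,
    ENNReal.ofReal (Real.exp (((n : ℕ) ^ d : ℕ) * (q.2 + ε))) ≤ μ.cramer n (p.ball q.1 η)}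

theorem rateSet_snd_nonpos {p : Seminorm ℝ X} {q : X × ℝ} (h : q ∈ μ.rateSet p) : q.2 ≤ 0 := by
  obtain ⟨η, -, -, ε, hε, h⟩ := h
  obtain ⟨n, hn⟩ := h.exists
  have h1 : ENNReal.ofReal (Real.exp (((n : ℕ) ^ d : ℕ) * (q.2 + ε))) ≤ ENNReal.ofReal 1 := by
    rw [ENNReal.ofReal_one]
    exact hn.trans prob_le_one
  rw [ENNReal.ofReal_le_ofReal_iff zero_le_one, Real.exp_le_one_iff] at h1
  have hN : (0 : ℝ) < ((n : ℕ) ^ d : ℕ) := by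
    have : 0 < (n : ℕ) ^ d := by positivity
    exact_mod_cast this
  have := nonpos_of_mul_nonpos_right h1 hN
  linarith

theorem rateSet_of_le {p : Seminorm ℝ X} {y : X} {r r' : ℝ} (h : (y, r) ∈ μ.rateSet p)
    (hr : r' ≤ r) : (y, r') ∈ μ.rateSet p := by
  obtain ⟨η, h1, h2, ε, hε, h⟩ := h
  refine ⟨η, h1, h2, ε, hε, h.mono fun n hn => le_trans ?_ hn⟩
  gcongr

/-- Moving the centre only enlarges the radius, and lowering the level provides the required `ε`.
Openness follows, and membership will always be proved this way. -/
theorem rateSet_of_lt {p : Seminorm ℝ X} {y y' : X} {r r' η : ℝ} (hη : 0 < η)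
    (h : ∀ᶠ n : ℕ+ in atTop,
      ENNReal.ofReal (Real.exp (((n : ℕ) ^ d : ℕ) * r)) ≤ μ.cramer n (p.ball y η))
    (hy : η + p (y - y') < 1) (hr : r' < r) : (y', r') ∈ μ.rateSet p := by
  refine ⟨η + p (y - y'), add_pos_of_pos_of_nonneg hη (apply_nonneg _ _), hy, r - r',
    sub_pos.2 hr, h.mono fun n hn => ?_⟩
  simp only [add_sub_cancel]
  refine hn.trans (measure_mono fun x hx => ?_)
  rw [Seminorm.mem_ball] at hx ⊢
  have : x - y' = (x - y) + (y - y') := by abel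
  rw [this]
  exact (map_add_le_add p _ _).trans_lt (by linarith)

theorem isOpen_rateSet [TopologicalSpace X] [IsTopologicalAddGroup X] {p : Seminorm ℝ X}
    (hp : Continuous p) : IsOpen (μ.rateSet p) := by
  rw [isOpen_iff_eventually]
  rintro ⟨y, r⟩ ⟨η, hη, hη1, ε, hε, h⟩
  have h1 : ∀ᶠ q : X × ℝ in 𝓝 (y, r), η + p (y - q.1) < 1 := by
    have : Continuous fun q : X × ℝ => η + p (y - q.1) := by fun_prop
    refine this.continuousAt.eventually_lt_const ?_
    simpa using hη1
  have h2 : ∀ᶠ q : X × ℝ in 𝓝 (y, r), q.2 < r + ε :=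
    continuous_snd.continuousAt.eventually_lt_const (by simpa using hε)
  filter_upwards [h1, h2] with q hq1 hq2
  exact rateSet_of_lt hη h hq1 hq2

end InvariantSystem

end RateSets

/-! ### Convexity of the rate set and Legendre duality -/

section Duality

open LatticeBox

variable {X : Type*} [AddCommGroup X] [Module ℝ X] {d : ℕ} [MeasurableSpace X]

namespace InvariantSystem

variable {μ : InvariantSystem d X}

/-- About `u * T` of `T` tiles get a mean near `y₁` and the others a mean near `y₂`; the rates
combine in the same proportions. One such arrangement suffices at exponential scale. -/
theorem LowerAsymptoticallyDecoupled.convex_rateSet (hdec : μ.LowerAsymptoticallyDecoupled)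
    (hd : 0 < d) {p : Seminorm ℝ X}
    (hmeas : ∀ (y : X) (r : ℝ), 0 < r → MeasurableSet (p.ball y r)) {t a : ℝ} (ht : 0 < t)
    (ha₀ : 0 < a) (ha : μ.SpinLowerBound (p.ball 0 t) a) : Convex ℝ (μ.rateSet p) := by
  classical
  rintro ⟨y₁, r₁⟩ ⟨η₁, hη₁, hη₁', ε₁, hε₁, h₁⟩ ⟨y₂, r₂⟩ ⟨η₂, hη₂, hη₂', ε₂, hε₂, h₂⟩ u v hu hv huv
  simp only [Prod.smul_mk, Prod.mk_add_mk, smul_eq_mul] at h₁ h₂ ⊢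
  set η := max η₁ η₂
  set ε := min ε₁ ε₂
  have hη : 0 < η := lt_max_of_lt_left hη₁
  have hη' : η < 1 := max_lt hη₁' hη₂'
  have hε : 0 < ε := lt_min hε₁ hε₂
  set ybar := u • y₁ + v • y₂
  set rbar := u * r₁ + v * r₂
  -- Half of the surplus `ε` pays for rounding `u * T` to an integer, the other half for the losses
  -- `δ * (1 + |R|)`.
  set R := rbar + ε / 2
  obtain ⟨δ, hδ, hδ1, hδ2⟩ : ∃ δ > 0, δ * (3 + p ybar) < 1 - η ∧ δ * (1 + |R|) < ε / 2 := by
    have e1 : 0 < 3 + p ybar := by have := apply_nonneg p ybar; linarith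
    have e2 : 0 < 1 + |R| := by positivity
    refine ⟨min ((1 - η) / (3 + p ybar)) (ε / 2 / (1 + |R|)) / 2, ?_, ?_, ?_⟩
    · have := sub_pos.2 hη'
      positivity
    · rw [← lt_div_iff₀ e1]
      refine (half_lt_self ?_).trans_le (min_le_left _ _)
      have := sub_pos.2 hη'
      positivity
    · rw [← lt_div_iff₀ e2]
      refine (half_lt_self ?_).trans_le (min_le_right _ _)
      have := sub_pos.2 hη'
      positivity
  obtain ⟨m, ⟨ρ, hρ1, hρ2, H⟩, hm₁, hm₂⟩ :=
    ((hdec.eventually_le_cramer_ball hd hmeas ht ha₀ ha hδ).and (h₁.and h₂)).exists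
  have hM : (0 : ℝ) < ((m : ℕ) ^ d : ℕ) := by
    have : 0 < (m : ℕ) ^ d := by positivity
    exact_mod_cast this
  set M : ℝ := (((m : ℕ) ^ d : ℕ) : ℝ)
  let A : Bool → Set X := fun b => if b then p.ball y₁ η₁ else p.ball y₂ η₂
  let y : Bool → X := fun b => if b then y₁ else y₂
  have hlarge1 : ∀ᶠ T : ℕ in atTop, p (y₁ - y₂) ≤ T * δ :=
    (tendsto_natCast_atTop_atTop.atTop_mul_const hδ).eventually_ge_atTop _
  have hlarge2 : ∀ᶠ T : ℕ in atTop, |r₁ - r₂| ≤ T * (ε / 2) :=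
    (tendsto_natCast_atTop_atTop.atTop_mul_const (half_pos hε)).eventually_ge_atTop _
  have key := H (A := A) (y := y) (ybar := ybar) (η := η) (R := R) ?_ hη.le ?_ ?_
  · refine rateSet_of_lt (by positivity) key ?_ ?_
    · have : ρ • ybar - ybar = (ρ - 1) • ybar := by module
      rw [this, map_smul_eq_mul, Real.norm_eq_abs, abs_of_nonpos (by linarith)]
      have := mul_le_mul_of_nonneg_right (show -(ρ - 1) ≤ δ by linarith) (apply_nonneg p ybar)
      linarith
    · have h3 : |(ρ - 1) * R| ≤ δ * |R| := by
        rw [abs_mul, abs_of_nonpos (show ρ - 1 ≤ 0 by linarith)]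
        exact mul_le_mul_of_nonneg_right (by linarith) (abs_nonneg _)
      have := (abs_le.1 h3).1
      have h4 : R = rbar + ε / 2 := rfl
      linarith
  · intro b
    cases b
    · exact hmeas _ _ hη₂
    · exact hmeas _ _ hη₁
  · intro b
    cases b
    · exact Seminorm.ball_mono (le_max_right _ _)
    · exact Seminorm.ball_mono (le_max_left _ _)
  · filter_upwards [hlarge1, hlarge2] with T hT1 hT2
    have hk : ⌊u * T⌋₊ ≤ T := by
      refine Nat.floor_le_of_le ?_
      exact mul_le_of_le_one_left (Nat.cast_nonneg T) (by linarith)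
    obtain ⟨J, -, hJ⟩ := Finset.exists_subset_card_eq (s := (Finset.univ : Finset (Fin T)))
      (n := ⌊u * T⌋₊) (by simpa using hk)
    have hJc : Jᶜ.card = T - ⌊u * T⌋₊ := by
      rw [Finset.card_compl, hJ, Fintype.card_fin]
    set k := ⌊u * T⌋₊
    have hk1 : (k : ℝ) ≤ u * T := Nat.floor_le (by positivity)
    have hk2 : u * T - 1 < k := Nat.sub_one_lt_floor _
    have hkabs : |(k : ℝ) - u * T| ≤ 1 := by rw [abs_le]; constructor <;> linarith
    refine ⟨{fun j => decide (j ∈ J)}, by simp, ?_, ?_⟩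
    · intro f hf
      rw [Finset.mem_singleton.1 hf]
      have h3 : ∑ j, y (decide (j ∈ J)) = (k : ℝ) • y₁ + ((T : ℝ) - k) • y₂ := by
        rw [← Finset.sum_add_sum_compl J]
        rw [Finset.sum_congr rfl (g := fun _ => y₁) fun j hj => by simp [y, hj],
          Finset.sum_congr (s₁ := Jᶜ) rfl (g := fun _ => y₂) fun j hj => by
            simp [y, Finset.mem_compl.1 hj]]
        rw [Finset.sum_const, Finset.sum_const, hJ, hJc, ← Nat.cast_sub hk,
          Nat.cast_smul_eq_nsmul, Nat.cast_smul_eq_nsmul]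
      have h4 : ∑ j, y (decide (j ∈ J)) - T • ybar = ((k : ℝ) - u * T) • (y₁ - y₂) := by
        rw [h3, ← Nat.cast_smul_eq_nsmul ℝ T]
        obtain rfl : v = 1 - u := by linarith
        simp only [ybar]
        module
      rw [h4, map_smul_eq_mul, Real.norm_eq_abs]
      exact (mul_le_of_le_one_left (apply_nonneg _ _) hkabs).trans hT1
    · rw [Finset.sum_singleton, ← Finset.prod_mul_prod_compl J]
      rw [Finset.prod_congr rfl (g := fun _ => μ.cramer m (p.ball y₁ η₁)) fun j hj => by
          simp [A, hj],
        Finset.prod_congr (s₁ := Jᶜ) rfl (g := fun _ => μ.cramer m (p.ball y₂ η₂)) fun j hj => by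
          simp [A, Finset.mem_compl.1 hj]]
      rw [Finset.prod_const, Finset.prod_const, hJ, hJc]
      refine le_trans ?_ (mul_le_mul' (pow_le_pow_left' hm₁ k) (pow_le_pow_left' hm₂ (T - k)))
      rw [← ENNReal.ofReal_pow (Real.exp_pos _).le, ← ENNReal.ofReal_pow (Real.exp_pos _).le,
        ← Real.exp_nat_mul, ← Real.exp_nat_mul, ← ENNReal.ofReal_mul (Real.exp_pos _).le,
        ← Real.exp_add, Nat.cast_sub hk]
      refine ENNReal.ofReal_le_ofReal (Real.exp_le_exp.2 ?_)
      have hε1 : ε ≤ ε₁ := min_le_left _ _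
      have hε2 : ε ≤ ε₂ := min_le_right _ _
      have h5 : |((k : ℝ) - u * T) * (r₁ - r₂)| ≤ |r₁ - r₂| := by
        rw [abs_mul]
        exact mul_le_of_le_one_left (abs_nonneg _) hkabs
      have h6 := (abs_le.1 h5).1
      have h7 : (k : ℝ) * ε ≤ k * ε₁ := by gcongr
      have h8 : ((T : ℝ) - k) * ε ≤ (T - k) * ε₂ := by
        have : (k : ℝ) ≤ T := by exact_mod_cast hk
        have := sub_nonneg.2 this
        gcongr
      have h9 : T * R ≤ k * (r₁ + ε₁) + (T - k) * (r₂ + ε₂) := by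
        have hR : R = u * r₁ + v * r₂ + ε / 2 := rfl
        obtain rfl : v = 1 - u := by linarith
        rw [hR]
        linarith
      have := mul_le_mul_of_nonneg_left h9 hM.le
      linarith

theorem entropy_le_pressure_sub [TopologicalSpace X] {C₀ : Set (Set X)} (hX : IsMeasurableLCS C₀) (x : X)
    (l : X →L[ℝ] ℝ) : μ.entropy C₀ x ≤ μ.pressure l - ((l x : ℝ) : EReal) := by
  by_contra! hlt
  obtain ⟨b, hb1, hb2⟩ := EReal.lt_iff_exists_real_btwn.1 hlt
  -- The margin `b' - b` is the variation of `l` allowed on `C`.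
  obtain ⟨b', hb1', hb2'⟩ := EReal.lt_iff_exists_real_btwn.1 hb2
  have hbb : b < b' := by exact_mod_cast hb1'
  rw [EReal.sub_lt_iff (Or.inl (EReal.coe_ne_bot _)) (Or.inl (EReal.coe_ne_top _)),
    ← EReal.coe_add] at hb1
  obtain ⟨C, hC, hCl⟩ := hX.nhds_zero_basis.mem_iff.1
    (l.continuous.continuousAt.preimage_mem_nhds (x := 0)
      (Ioi_mem_nhds (show b - b' < l 0 by simpa using hbb)))
  have h1 := eventually_lt_of_lt_liminf (hb2'.trans_le (iInf₂_le C hC))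
  have h2 := eventually_lt_of_limsup_lt hb1
  obtain ⟨n, hn1, hn2⟩ := (h1.and h2).exists
  rw [← ofReal_exp_lt_iff (card_sites_pos _)] at hn1
  rw [← not_le, ← ofReal_exp_le_iff (card_sites_pos _), not_le] at hn2
  set N : ℝ := ((cube d n).sites.card : ℝ)
  have hN : 0 ≤ N := Nat.cast_nonneg _
  have hmeas : MeasurableSet (x +ᵥ C) := hX.measurableSet_vadd _ _ (hX.subset hC).2
  have h3 : ENNReal.ofReal (Real.exp (N * (l x + (b - b')))) * μ.cramer n (x +ᵥ C) ≤
      ∫⁻ y, ENNReal.ofReal (Real.exp (N * l y)) ∂(μ.cramer n) := by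
    rw [← setLIntegral_const]
    refine (setLIntegral_mono' hmeas fun y hy => ENNReal.ofReal_le_ofReal
      (Real.exp_le_exp.2 ?_)).trans (setLIntegral_le_lintegral _ _)
    obtain ⟨c, hc, rfl⟩ := hy
    refine mul_le_mul_of_nonneg_left ?_ hN
    have : b - b' < l c := hCl hc
    simp only [vadd_eq_add, map_add]
    linarith
  have h4 : ENNReal.ofReal (Real.exp (N * (b + l x))) ≤
      ENNReal.ofReal (Real.exp (N * (l x + (b - b')))) * μ.cramer n (x +ᵥ C) := by
    refine le_trans (le_of_eq ?_) (mul_le_mul_right hn1.le _)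
    rw [← ENNReal.ofReal_mul (Real.exp_pos _).le, ← Real.exp_add]
    congr 2
    ring
  exact (hn2.trans_le (h4.trans h3)).false

variable [TopologicalSpace X] [IsTopologicalAddGroup X] [ContinuousSMul ℝ X]

/-- Below the pressure, the rate set contains a point (together with a neighbourhood of fixed
size) above the corresponding level. -/
theorem exists_mem_rateSet_of_lt_pressure {C₀ : Set (Set X)} (hX : IsMeasurableLCS C₀)
    (hd : 0 < d) {D : Set X} (h_dec : μ.LowerAsymptoticallyDecoupled)
    (h_ctrl : μ.LocallyControlled) (h_carried : μ.CarriedBy (fieldsIn d D))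
    (h_tight : μ.LocallyConvexTight D) {p : Seminorm ℝ X} (hp : p.ball 0 1 ∈ C₀)
    {l : X →L[ℝ] ℝ} {b : ℝ} (hb : (b : EReal) < μ.pressure l) :
    ∃ (y : X) (r : ℝ), b < l y + r ∧ ∀ c, p c < 1 / 4 → (y + c, r) ∈ μ.rateSet p := by
  obtain ⟨t, ht, a, ha₀, ha⟩ := h_ctrl.exists_spinLowerBound hX hp
  obtain ⟨b₁, hb₁, hb₁'⟩ := EReal.lt_iff_exists_real_btwn.1 hb
  have hbb : b < b₁ := by exact_mod_cast hb₁
  -- The bound `1 / 12` gives radius `1 / 4 + 3 * δ ≤ 1 / 2`, leaving room for a shift `c` with `p c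
  -- < 1 / 4`. The second condition covers all losses of level.
  obtain ⟨δ, hδ, hδ1, hδ2⟩ : ∃ δ : ℝ, 0 < δ ∧ δ ≤ 1 / 12 ∧ δ * (9 + |b₁|) ≤ b₁ - b := by
    have : 0 < 9 + |b₁| := by positivity
    refine ⟨min (1 / 12) ((b₁ - b) / (9 + |b₁|)), ?_, min_le_left _ _, ?_⟩
    · have := sub_pos.2 hbb
      positivity
    · rw [← le_div_iff₀ this]
      exact min_le_right _ _
  -- shrink to a ball on which `l` is small
  have hN : p.ball 0 (1 / 4) ∩ l ⁻¹' Set.Iio δ ∈ 𝓝 (0 : X) := by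
    refine inter_mem ?_ ?_
    · have := hX.nhds_zero_basis.mem_of_mem (hX.smul_mem (1 / 4) (by norm_num) _ hp)
      simpa [Seminorm.smul_ball_zero] using this
    · exact l.continuous.continuousAt.preimage_mem_nhds (Iio_mem_nhds (by simpa using hδ))
  obtain ⟨C₁, hC₁, hC₁'⟩ := hX.nhds_zero_basis.mem_iff.1 hN
  obtain ⟨p₁, hp₁c, rfl⟩ := hX.exists_seminorm hC₁
  have hmeas₁ : ∀ y : X, MeasurableSet (p₁.ball y 1) := fun y =>
    hX.measurableSet_ball hC₁ y one_pos
  have hnhds₁ : ∀ y : X, p₁.ball y 1 ∈ 𝓝 y := fun y => by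
    have : Continuous fun x => p₁ (x - y) := by fun_prop
    exact this.continuousAt.preimage_mem_nhds (Iio_mem_nhds (by simp))
  have hball : ∀ y, p₁.ball y 1 ⊆ p.ball y (1 / 4) := by
    intro y x hx
    have := (hC₁' (show x - y ∈ p₁.ball 0 1 by
      rw [Seminorm.mem_ball_zero]; exact (p₁.mem_ball).1 hx)).1
    rwa [Seminorm.mem_ball_zero] at this
  -- The pressure is a limsup, so its integral is large only for infinitely many `m`; the tiling
  -- bound holds for all large `m`, so both hold for some `m`.
  obtain ⟨m, hm, ρ, hρ1, hρ2, H⟩ := ((frequently_lt_of_lt_limsup (by isBoundedDefault)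
    hb₁').and_eventually (h_dec.eventually_le_cramer_ball hd
    (fun y _ hr => hX.measurableSet_ball hp y hr) ht ha₀ ha hδ)).exists
  rw [← ofReal_exp_lt_iff (card_sites_pos _), card_sites] at hm
  simp only [cube] at hm
  have hM : (0 : ℝ) < ((m : ℕ) ^ d : ℕ) := by
    have : 0 < (m : ℕ) ^ d := by positivity
    exact_mod_cast this
  obtain ⟨k, y, A, hA, hAd, hAy, hZ⟩ := exists_finite_partition_exp_sum (P := μ.cramer m)
    (p := p₁) hmeas₁
    (fun γ hγ => exists_finset_cramer_compl_le h_carried h_tight hnhds₁ hmeas₁ m hγ)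
    (l := (l : X →ₗ[ℝ] ℝ)) (fun x hx => (hC₁' hx).2.le) hM.le hm
  obtain ⟨ybar, hybar⟩ := exists_eventually_tilted_lower_bound
    (fun i => ENNReal.toReal_nonneg (a := μ.cramer m (A i))) y p (l : X →ₗ[ℝ] ℝ) hM
    ((Real.exp_pos _).trans_le hZ) hδ
  set M : ℝ := (((m : ℕ) ^ d : ℕ) : ℝ)
  -- The partition sum has rate at least `b₁ - δ` after discretisation, and undoing the tilt costs
  -- `l ybar + 2 * δ`.
  set R : ℝ := b₁ - δ - l ybar - 2 * δ with hR
  have key := H (A := A) (y := y) (ybar := ybar) (η := 1 / 4) (R := R) hA (by norm_num)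
    (fun i => (hAy i).trans (hball _)) ?_
  · refine ⟨ρ • ybar, ρ * R - 2 * δ, ?_, ?_⟩
    · rw [map_smul, smul_eq_mul]
      have h3 : |(1 - ρ) * (b₁ - 3 * δ)| ≤ δ * (|b₁| + 3 * δ) := by
        rw [abs_mul, abs_of_nonneg (show 0 ≤ 1 - ρ by linarith)]
        refine mul_le_mul (by linarith) ?_ (abs_nonneg _) hδ.le
        refine (abs_sub _ _).trans ?_
        rw [abs_of_pos (show 0 < 3 * δ by positivity)]
      have h4 := (abs_le.1 h3).2
      have h5 : δ * (3 * δ) < δ * 3 := by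
        apply mul_lt_mul_of_pos_left _ hδ
        linarith
      rw [hR]
      linarith
    · intro c hc
      refine rateSet_of_lt (by positivity) key ?_ (by linarith)
      rw [sub_add_cancel_left, map_neg_eq_map]
      linarith
  · filter_upwards [hybar] with T hT
    obtain ⟨F, hF1, hF2⟩ := hT
    refine ⟨F, ?_, hF1, ?_⟩
    · intro f _ f' _ hne
      obtain ⟨j, hj⟩ := Function.ne_iff.1 hne
      exact Set.disjoint_pi.2 ⟨j, Set.mem_univ _, hAd hj⟩
    · have h3 : ∑ f ∈ F, ∏ j, μ.cramer m (A (f j)) =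
          ENNReal.ofReal (∑ f ∈ F, ∏ j, (μ.cramer m (A (f j))).toReal) := by
        rw [ENNReal.ofReal_sum_of_nonneg fun f _ => Finset.prod_nonneg fun j _ =>
          ENNReal.toReal_nonneg]
        refine Finset.sum_congr rfl fun f _ => ?_
        rw [ENNReal.ofReal_prod_of_nonneg fun j _ => ENNReal.toReal_nonneg]
        exact Finset.prod_congr rfl fun j _ => (ENNReal.ofReal_toReal (measure_ne_top _ _)).symm
      rw [h3]
      refine ENNReal.ofReal_le_ofReal (le_trans ?_ hF2)
      refine le_trans ?_ (mul_le_mul_of_nonneg_right (pow_le_pow_left₀ (Real.exp_pos _).le hZ T)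
        (Real.exp_pos _).le)
      rw [← Real.exp_nat_mul, ← Real.exp_add]
      refine Real.exp_le_exp.2 (le_of_eq ?_)
      rw [hR, ContinuousLinearMap.coe_coe]
      ring

/-- A functional separating `(x, a)` from the rate set is `(y, r) ↦ l y + r * β`. The sign of `β`
decides which multiple of `l` to test against the pressure. -/
theorem iInf_pressure_sub_le_entropy {C₀ : Set (Set X)} (hX : IsMeasurableLCS C₀)
    (hd : 0 < d) {D : Set X} (h_dec : μ.LowerAsymptoticallyDecoupled)
    (h_ctrl : μ.LocallyControlled) (h_carried : μ.CarriedBy (fieldsIn d D))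
    (h_tight : μ.LocallyConvexTight D) (x : X) :
    ⨅ l : X →L[ℝ] ℝ, (μ.pressure l - ((l x : ℝ) : EReal)) ≤ μ.entropy C₀ x := by
  by_contra! hlt
  obtain ⟨a, ha1, ha2⟩ := EReal.lt_iff_exists_real_btwn.1 hlt
  simp only [entropy, iInf_lt_iff] at ha1
  obtain ⟨C, hC, hCa⟩ := ha1
  obtain ⟨p, hpc, rfl⟩ := hX.exists_seminorm hC
  obtain ⟨t, ht, α, hα₀, hα⟩ := h_ctrl.exists_spinLowerBound hX hC
  have hnot : (x, a) ∉ μ.rateSet p := by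
    rintro ⟨η, hη, hη1, ε, hε, h⟩
    refine hCa.not_ge (le_liminf_of_le (by isBoundedDefault) (h.mono fun n hn => ?_))
    rw [← ofReal_exp_le_iff (card_sites_pos _), card_sites]
    simp only [cube]
    refine le_trans (ENNReal.ofReal_le_ofReal (Real.exp_le_exp.2 ?_)) (hn.trans (measure_mono ?_))
    · exact mul_le_mul_of_nonneg_left (by simp only; linarith) (Nat.cast_nonneg _)
    · refine (Seminorm.ball_mono hη1.le).trans ?_
      rw [p.ball_eq_vadd_smul x one_pos, one_smul]
  have hpress : ∀ l : X →L[ℝ] ℝ, ((a + l x : ℝ) : EReal) < μ.pressure l := by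
    intro l
    have := ha2.trans_le (iInf_le _ l)
    rw [EReal.lt_sub_iff_add_lt (Or.inl (EReal.coe_ne_bot _)) (Or.inl (EReal.coe_ne_top _))] at this
    exact_mod_cast this
  have hpoint := fun l : X →L[ℝ] ℝ =>
    exists_mem_rateSet_of_lt_pressure hX hd h_dec h_ctrl h_carried h_tight hC (hpress l)
  have hmem : ∀ {y : X} {r : ℝ}, (∀ c, p c < 1 / 4 → (y + c, r) ∈ μ.rateSet p) →
      (y, r) ∈ μ.rateSet p := fun h => by simpa using h 0 (by simp)
  obtain ⟨f, hf⟩ := geometric_hahn_banach_open_point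
    (h_dec.convex_rateSet hd (fun y _ hr => hX.measurableSet_ball hC y hr) ht hα₀ hα)
    (isOpen_rateSet hpc) hnot
  set l : X →L[ℝ] ℝ := f.comp (ContinuousLinearMap.inl ℝ X ℝ) with hl
  set β : ℝ := f (0, 1)
  have hfl : ∀ (y : X) (r : ℝ), f (y, r) = l y + r * β := by
    intro y r
    have : (y, r) = (y, (0 : ℝ)) + r • ((0 : X), (1 : ℝ)) := by simp
    rw [this, map_add, map_smul, smul_eq_mul]
    rfl
  have hsep : ∀ {y : X} {r : ℝ}, (y, r) ∈ μ.rateSet p → l y + r * β < l x + a * β := by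
    intro y r h
    simpa only [hfl] using hf _ h
  rcases lt_trichotomy β 0 with hβ | hβ | hβ
  -- Impossible case: levels can be lowered without bound inside the rate set.
  · obtain ⟨y, r, -, hy⟩ := hpoint 0
    have hy := hmem hy
    have h1 : ∀ s : ℝ, 0 ≤ s → l y + (r - s) * β < l x + a * β := fun s hs =>
      hsep (rateSet_of_le hy (by linarith))
    have h2 := h1 (max 0 ((l x + a * β - l y - r * β) / (-β))) (le_max_left _ _)
    have h3 : (l x + a * β - l y - r * β) / (-β) * (-β) ≤
        max 0 ((l x + a * β - l y - r * β) / (-β)) * (-β) :=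
      mul_le_mul_of_nonneg_right (le_max_right _ _) (by linarith)
    rw [div_mul_cancel₀ _ (by linarith)] at h3
    linarith
  -- Vertical hyperplane: `l y < l x` on the rate set. The shifts `c` of fixed size strengthen this
  -- to a gap `l c`, which a large multiple of `l` amplifies.
  · simp only [hβ, mul_zero, add_zero] at hsep
    by_cases hl0 : l = 0
    · obtain ⟨y, r, -, hy⟩ := hpoint 0
      have := hsep (hmem hy)
      simp [hl0] at this
    · obtain ⟨c, hc, hlc⟩ : ∃ c, p c < 1 / 4 ∧ 0 < l c := by
        obtain ⟨z, hz⟩ : ∃ z, l z ≠ 0 := by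
          by_contra! h
          exact hl0 (ContinuousLinearMap.ext h)
        have hpz : 0 ≤ p z := apply_nonneg p z
        refine ⟨(l z / |l z| * (1 / (5 * (1 + p z)))) • z, ?_, ?_⟩
        · rw [map_smul_eq_mul, norm_mul, Real.norm_eq_abs, abs_div, abs_abs,
            div_self (abs_ne_zero.2 hz), one_mul, Real.norm_of_nonneg (by positivity),
            div_mul_eq_mul_div, div_lt_iff₀ (by positivity)]
          linarith
        · rw [map_smul, smul_eq_mul]
          have : l z / |l z| * (1 / (5 * (1 + p z))) * l z =
              (l z * l z) / |l z| * (1 / (5 * (1 + p z))) := by ring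
          rw [this]
          have := mul_self_pos.2 hz
          have := abs_pos.2 hz
          positivity
      -- The multiplier turns the gap `l c` into `|a|`; with `r ≤ 0` this would force `a + |a| < 0`.
      obtain ⟨y, r, hyr, hy⟩ := hpoint ((|a| / l c) • l)
      have hr : r ≤ 0 := rateSet_snd_nonpos (hmem hy)
      have h1 := hsep (hy c hc)
      rw [map_add] at h1
      simp only [_root_.smul_apply, smul_eq_mul] at hyr
      have h2 : |a| / l c * (l y + l c) ≤ |a| / l c * l x :=
        mul_le_mul_of_nonneg_left h1.le (by positivity)
      rw [mul_add, div_mul_cancel₀ _ hlc.ne'] at h2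
      have := neg_abs_le a
      linarith
  -- Main case: after normalising `β` to one, the pressure bound and the separation contradict each
  -- other directly.
  · obtain ⟨y, r, hyr, hy⟩ := hpoint (β⁻¹ • l)
    have h1 := hsep (hmem hy)
    simp only [_root_.smul_apply, smul_eq_mul] at hyr
    have h2 := mul_lt_mul_of_pos_right hyr hβ
    have h3 : (a + β⁻¹ * l x) * β = a * β + l x := by field_simp
    have h4 : (β⁻¹ * l y + r) * β = l y + r * β := by field_simp
    linarith

end InvariantSystem

end Duality

theorem mainTheorem4 {X : Type*} [AddCommGroup X] [Module ℝ X] [TopologicalSpace X]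
    [IsTopologicalAddGroup X] [ContinuousSMul ℝ X] [MeasurableSpace X]
    (C₀ : Set (Set X)) (hX : IsMeasurableLCS C₀)
    (d : ℕ) (hd : 0 < d) (μ : InvariantSystem d X)
    (D : Set X) (hD : Convex ℝ D)
    (h_dec : μ.LowerAsymptoticallyDecoupled)
    (h_ctrl : μ.LocallyControlled)
    (h_carried : μ.CarriedBy (fieldsIn d D))
    (h_tight : μ.LocallyConvexTight D) (x : X) :
    μ.entropy C₀ x = ⨅ l : X →L[ℝ] ℝ, (μ.pressure l - ((l x : ℝ) : EReal)) :=
  le_antisymm (le_iInf fun l => InvariantSystem.entropy_le_pressure_sub hX x l)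
    (InvariantSystem.iInf_pressure_sub_le_entropy hX hd h_dec h_ctrl h_carried h_tight x)
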